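/- Let $\mathbb K$ be a field. An arrangement $(\mathcal A,V)$ is a finite set $\mathcal A$ of linear hyperplanes (subspaces of codimension one) in a finite-dimensional $\mathbb K$-vector space $V$. For $H_0\in\mathcal A$ put $\mathcal A'=\mathcal A\setminus\{H_0\}$, an arrangement in $V$, and $\mathcal A''=\{H_0\cap H\mid H\in\mathcal A'\}$, an arrangement in $H_0$. A partition of $\mathcal A$ is a set $\pi$ of non-empty pairwise disjoint blocks with union $\mathcal A$. The class of \emph{inductive factorizations} is the smallest class of pairs $(\mathcal A,\pi)$, with $\pi$ a partition of $\mathcal A$, such that (i) $(\varnothing,\varnothing)$ belongs to it for the empty arrangement in every $V$ (with its empty partition); (ii) $(\mathcal A,\pi)$ belongs to it whenever there are a block $\pi_1\in\pi$ and a hyperplane $H_0\in\pi_1$ such that the map $\mathcal A\setminus\pi_1\to\mathcal A''$, $H\mapsto H_0\cap H$, is bijective, and both $(\mathcal A',\pi')$ and $(\mathcal A'',\pi'')$ belong to it, where $\pi'$ consists of the non-empty sets $B\cap\mathcal A'$ with $B\in\pi$, and $\pi''$ consists of the sets $\{H_0\cap H\mid H\in B\}$ with $B\in\pi\setminus\{\pi_1\}$.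 $\mathcal A$ is \emph{inductively factored} if $(\mathcal A,\pi)$ belongs to this class for some $\pi$. Let $S=\mathrm{Sym}(V^*)$, and for $H\in\mathcal A$ let $\alpha_H\in V^*$ have kernel $H$. The arrangement $\mathcal A$ is \emph{free} if the $S$-module $D(\mathcal A)=\{\theta\in\mathrm{Der}_{\mathbb K}(S)\mid\theta(\alpha_H)\in\alpha_H S\text{ for all }H\in\mathcal A\}$ has a basis $\theta_1,\dots,\theta_\ell$ of homogeneous derivations, i.e. $\theta_i(V^*)\subseteq S_{d_i}$ for suitable $d_i\ge 0$; the multiset of \emph{exponents} of $\mathcal A$ is then $\exp\mathcal A=\{d_1,\dots,d_\ell\}$. \textbf{Proposition.} Let $(\mathcal A_1,V_1)$ and $(\mathcal A_2,V_2)$ be two arrangements over $\mathbb K$, and let $\mathcal A_1\times\mathcal A_2=\{H_1\oplus V_2\mid H_1\in\mathcal A_1\}\cup\{V_1\oplus H_2\mid H_2\in\mathcal A_2\}$ be their product, an arrangement in $V_1\oplus V_2$. Then $\mathcal A_1\times\mathcal A_2$ is inductively factored if and only if both $\mathcal A_1$ and $\mathcal A_2$ are inductively factored. In that case $\mathcal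 A_1$, $\mathcal A_2$ and $\mathcal A_1\times\mathcal A_2$ are free, their multisets of exponents are well defined, and $\exp(\mathcal A_1\times\mathcal A_2)$ is the multiset union (with multiplicities added) of $\exp\mathcal A_1$ and $\exp\mathcal A_2$. -/

import Mathlib

universe u v w

/-- A central hyperplane arrangement in the `K`-vector space `V`: a finite set of linear hyperplanes
(maximal proper subspaces, i.e. subspaces of codimension one) of `V`. -/
@[ext]
structure HyperplaneArrangement (K : Type u) [Field K] (V : Type v) [AddCommGroup V]
    [Module K V] where
  /-- The set of hyperplanes of the arrangement. -/
  hyperplanes : Set (Submodule K V)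
  finite : hyperplanes.Finite
  isCoatom : ∀ H ∈ hyperplanes, IsCoatom H

namespace HyperplaneArrangement

section

variable {K : Type u} [Field K] {V : Type v} [AddCommGroup V] [Module K V]
  {W : Type w} [AddCommGroup W] [Module K W]

variable (K V) in
/-- The empty arrangement in `V`. -/
def empty : HyperplaneArrangement K V where
  hyperplanes := ∅
  finite := Set.finite_empty
  isCoatom := fun _ h => h.elim

/-- The deletion `A' = A \ {H₀}`. -/
def deletion (A : HyperplaneArrangement K V) (H₀ : Submodule K V) : HyperplaneArrangement K V where
  hyperplanes := A.hyperplanes \ {H₀}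
  finite := A.finite.subset Set.sdiff_subset
  isCoatom := fun H h => A.isCoatom H h.1

/-- The intersection `X ∩ H`, as a subspace of the vector space `X`. -/
def interIn (X H : Submodule K V) : Submodule K X := H.comap X.subtype

theorem isCoatom_interIn {X H : Submodule K V} (hH : IsCoatom H) (hX : ¬ X ≤ H) :
    IsCoatom (interIn X H) := by
  rcases Submodule.isCoatom_comap_or_eq_top X.subtype hH with h | h
  · exact h
  · exact absurd (fun x hx => by
      have hm : (⟨x, hx⟩ : X) ∈ H.comap X.subtype := by rw [h]; trivial
      exact hm) hX

/-- The restriction `(A^X, X)`, where `A^X = {X ∩ H | H ∈ A, X ⊄ H}`. For `X = H₀ ∈ A` this is the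
arrangement `A''` of the triple `(A, A', A'')` associated with `H₀`. -/
def restriction (A : HyperplaneArrangement K V) (X : Submodule K V) :
    HyperplaneArrangement K X where
  hyperplanes := interIn X '' {H | H ∈ A.hyperplanes ∧ ¬ X ≤ H}
  finite := (A.finite.subset fun _ h => h.1).image _
  isCoatom := by
    rintro _ ⟨H, ⟨hH, hX⟩, rfl⟩
    exact isCoatom_interIn (A.isCoatom H hH) hX

/-- For `H₀ ∈ A`, the restriction to `H₀` is `A'' = {H₀ ∩ H | H ∈ A'}`. -/
theorem restriction_hyperplanes (A : HyperplaneArrangement K V) {H₀ : Submodule K V}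
    (h₀ : H₀ ∈ A.hyperplanes) :
    (A.restriction H₀).hyperplanes = interIn H₀ '' (A.deletion H₀).hyperplanes := by
  have : {H | H ∈ A.hyperplanes ∧ ¬ H₀ ≤ H} = A.hyperplanes \ {H₀} := by
    ext H
    refine and_congr_right fun hH => not_congr ⟨fun h => ?_, fun h => ?_⟩
    · rcases (A.isCoatom _ h₀).le_iff.1 h with h | h
      · exact absurd h (A.isCoatom _ hH).1
      · exact h
    · exact le_of_eq (Set.mem_singleton_iff.1 h).symm
  exact congrArg (fun s => interIn H₀ '' s) this

/-- The product arrangement in `V ⊕ W`, consisting of the hyperplanes `H₁ ⊕ W` for `H₁ ∈ A₁` and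
`V ⊕ H₂` for `H₂ ∈ A₂`. -/
def prod (A₁ : HyperplaneArrangement K V) (A₂ : HyperplaneArrangement K W) :
    HyperplaneArrangement K (V × W) where
  hyperplanes := (fun H₁ : Submodule K V => H₁.prod (⊤ : Submodule K W)) '' A₁.hyperplanes ∪
    (fun H₂ : Submodule K W => (⊤ : Submodule K V).prod H₂) '' A₂.hyperplanes
  finite := (A₁.finite.image _).union (A₂.finite.image _)
  isCoatom := by
    rintro _ (⟨H, hH, rfl⟩ | ⟨H, hH, rfl⟩)
    · have : H.prod (⊤ : Submodule K W) = H.comap (LinearMap.fst K V W) := by ext; simp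
      change IsCoatom (H.prod (⊤ : Submodule K W))
      rw [this, Submodule.isCoatom_comap_iff LinearMap.fst_surjective]
      exact A₁.isCoatom H hH
    · have : (⊤ : Submodule K V).prod H = H.comap (LinearMap.snd K V W) := by ext; simp
      change IsCoatom ((⊤ : Submodule K V).prod H)
      rw [this, Submodule.isCoatom_comap_iff LinearMap.snd_surjective]
      exact A₂.isCoatom H hH

/-- `π` is a partition of `A`: a set of non-empty, pairwise disjoint blocks with union `A`. The
empty arrangement has exactly one partition, the empty one. -/
structure IsPartition (A : HyperplaneArrangement K V) (π : Set (Set (Submodule K V))) : Prop where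
  nonempty : ∀ B ∈ π, B.Nonempty
  disjoint : π.PairwiseDisjoint id
  sUnion : ⋃₀ π = A.hyperplanes

/-- The induced partition `π'` of `A' = A \ {H₀}`: the non-empty sets `B ∩ A'` for `B ∈ π`. -/
def deletionPartition (A : HyperplaneArrangement K V) (π : Set (Set (Submodule K V)))
    (H₀ : Submodule K V) : Set (Set (Submodule K V)) :=
  {C | C.Nonempty ∧ ∃ B ∈ π, C = B ∩ (A.deletion H₀).hyperplanes}

/-- The induced family `π''` on `A''`, where `B₁` is the block of `π` containing `H₀`: the images
`{H₀ ∩ H | H ∈ B}` of the remaining blocks `B` of `π`. -/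
def restrictionPartition (π : Set (Set (Submodule K V))) (B₁ : Set (Submodule K V))
    (H₀ : Submodule K V) : Set (Set (Submodule K H₀)) :=
  (fun B => interIn H₀ '' B) '' (π \ {B₁})

end

/-- `IsInductiveFactorization A π` says that the pair `(A, π)` lies in the smallest class of pairs
(arrangement, partition) that contains all empty arrangements with the empty partition, and that
contains `(A, π)` whenever some hyperplane `H₀`, in the block `B₁` of `π`, is such that
`H ↦ H₀ ∩ H` is a bijection from `A \ B₁` onto `A''`, and `(A', π')` and `(A'', π'')` are in the
class. -/
inductive IsInductiveFactorization {K : Type u} [Field K] :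
    {V : Type v} → [AddCommGroup V] → [Module K V] →
      HyperplaneArrangement K V → Set (Set (Submodule K V)) → Prop
  | empty (V : Type v) [AddCommGroup V] [Module K V] :
      IsInductiveFactorization (HyperplaneArrangement.empty K V) ∅
  | addition {V : Type v} [AddCommGroup V] [Module K V] (A : HyperplaneArrangement K V)
      (π : Set (Set (Submodule K V))) (hπ : A.IsPartition π)
      (B₁ : Set (Submodule K V)) (hB₁ : B₁ ∈ π) (H₀ : Submodule K V) (hH₀ : H₀ ∈ B₁)
      (bij : Set.BijOn (interIn H₀) (A.hyperplanes \ B₁) (A.restriction H₀).hyperplanes)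
      (deletion : IsInductiveFactorization (A.deletion H₀) (A.deletionPartition π H₀))
      (restriction : IsInductiveFactorization (A.restriction H₀) (restrictionPartition π B₁ H₀)) :
      IsInductiveFactorization A π

section

variable {K : Type u} [Field K] {V : Type v} [AddCommGroup V] [Module K V]

/-- `A` is inductively factored if it has an inductive factorization. -/
def IsInductivelyFactored (A : HyperplaneArrangement K V) : Prop :=
  ∃ π : Set (Set (Submodule K V)), IsInductiveFactorization A π

/-- The module of `A`-derivations: the `K`-derivations `θ` of `S = Sym(V*)` such that
`θ(α_H) ∈ α_H S` for every `H ∈ A`, where `α_H ∈ V*` is a linear form with kernel `H` (unique up to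
a non-zero scalar, on which the condition does not depend). -/
def derivationModule (A : HyperplaneArrangement K V) :
    Submodule (SymmetricAlgebra K (Module.Dual K V))
      (Derivation K (SymmetricAlgebra K (Module.Dual K V))
        (SymmetricAlgebra K (Module.Dual K V))) where
  carrier := {θ | ∀ H ∈ A.hyperplanes, ∀ α : Module.Dual K V, LinearMap.ker α = H →
    SymmetricAlgebra.ι K (Module.Dual K V) α ∣ θ (SymmetricAlgebra.ι K (Module.Dual K V) α)}
  add_mem' := fun hθ hη H hH α hα => dvd_add (hθ H hH α hα) (hη H hH α hα)
  zero_mem' := fun _ _ _ _ => dvd_zero _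
  smul_mem' := fun f _ hθ H hH α hα => Dvd.dvd.mul_left (hθ H hH α hα) f

/-- `θ` is homogeneous of polynomial degree `d`: it maps each linear form into the degree `d` part
`S_d` of `S = Sym(V*)`, which is the `K`-span of the `d`-fold products of linear forms. -/
def IsHomogeneousDerivation
    (θ : Derivation K (SymmetricAlgebra K (Module.Dual K V))
      (SymmetricAlgebra K (Module.Dual K V))) (d : ℕ) : Prop :=
  ∀ α : Module.Dual K V, θ (SymmetricAlgebra.ι K (Module.Dual K V) α) ∈
    LinearMap.range (SymmetricAlgebra.ι K (Module.Dual K V)) ^ d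

/-- `A` is free with multiset of exponents `E`: the module of `A`-derivations has a basis over `S`
of homogeneous derivations, whose polynomial degrees form the multiset `E`. -/
def IsFreeWithExponents (A : HyperplaneArrangement K V) (E : Multiset ℕ) : Prop :=
  ∃ (n : ℕ) (b : Module.Basis (Fin n) (SymmetricAlgebra K (Module.Dual K V)) A.derivationModule)
    (d : Fin n → ℕ),
    (∀ i, IsHomogeneousDerivation (b i).1 (d i)) ∧ E = Finset.univ.val.map d

end

end HyperplaneArrangement

/-! The equivalence and the freeness come from separate inductions over the class of inductive
factorizations.

For the equivalence, the product is generalized to an arrangement in `U` pulled back along `f : U →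
V` and `g : U → W` with `(f, g)` surjective. A hyperplane `H₁ ⊕ W` is a subspace of `V ⊕ W`, not
literally a product, whereas joint pullbacks are stable under deletion and restriction. Hyperplanes
from the two sides never coincide (`comap_ne_comap`). If the pullback is factored, the traces of its
blocks factor `A₁`: an addition step at a hyperplane of `A₁` yields one for `A₁`, and a step at a
hyperplane of `A₂` is bypassed through its deletion (`IsInductiveFactorization.induced`).
Conversely, induction on a factorization of `A₁` ends at an empty first factor, where a pullback of
`A₂` alone remains (`IsInductiveFactorization.joint`).

For freeness, the non-zero exponents are shown to be the block sizes, with zeros filling up to `dim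
V` (`IsInductiveFactorization.exists_exponents`). Let `H₀ = ker α₀` lie in the block `B₁` and put `m
= |B₁| - 1`. Comparing blocks gives `exp A' = exp A'' ∪ {m}`. Let `q` be the product of the
restrictions to `H₀` of the forms `α_H`, `H ∈ B₁ \ {H₀}`. It divides the restriction of `θ(α₀)` for
every `θ ∈ D(A')` (`prod_symRestrict_dvd`). A rank count then forces some basis element of degree
`m` to attain `q` up to a scalar, and elimination with it gives a basis of `D(A)` in which `m` has
become `m + 1`.

Exponents are unique because a homogeneous derivation only involves basis elements of at most its
own degree. Block sizes and dimensions add up in a product, hence so do the exponents; the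
derivation modules of the product and of its factors need not be compared. -/

/-! ### Symmetric algebras: derivations, grading, primality of linear forms -/

namespace SymmetricAlgebra

variable {K : Type u} [Field K] {M : Type v} [AddCommGroup M] [Module K M]
  {N : Type w} [AddCommGroup N] [Module K N]

/-- The universal property gives an algebra map `a ↦ a + ε D(a)` into the square-zero extension;
multiplicativity is the Leibniz rule. -/
theorem exists_derivation (φ : M →ₗ[K] SymmetricAlgebra K M) :
    ∃ D : Derivation K (SymmetricAlgebra K M) (SymmetricAlgebra K M),
      ∀ m, D (ι K M m) = φ m := by
  let F : SymmetricAlgebra K M →ₐ[K]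
      TrivSqZeroExt (SymmetricAlgebra K M) (SymmetricAlgebra K M) :=
    lift ((TrivSqZeroExt.inlAlgHom K (SymmetricAlgebra K M)
      (SymmetricAlgebra K M)).toLinearMap ∘ₗ ι K M +
      (TrivSqZeroExt.inrHom (SymmetricAlgebra K M) (SymmetricAlgebra K M)).restrictScalars K ∘ₗ φ)
  have hF : ∀ m, F (ι K M m) = TrivSqZeroExt.inl (ι K M m) + TrivSqZeroExt.inr (φ m) :=
    fun m => lift_ι_apply _ m
  have h1 : (TrivSqZeroExt.fstHom K (SymmetricAlgebra K M) (SymmetricAlgebra K M)).comp F =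
      AlgHom.id K _ := by
    apply algHom_ext
    ext m
    simp [hF]
  have h1' : ∀ a, (F a).fst = a := fun a => DFunLike.congr_fun h1 a
  refine ⟨Derivation.mk' ((TrivSqZeroExt.sndHom (SymmetricAlgebra K M)
    (SymmetricAlgebra K M)).restrictScalars K ∘ₗ F.toLinearMap) ?_, fun m => ?_⟩
  · intro a b
    simp [h1', mul_comm]
  · simp [hF]

theorem derivation_ext {D₁ D₂ : Derivation K (SymmetricAlgebra K M) (SymmetricAlgebra K M)}
    (h : ∀ m, D₁ (ι K M m) = D₂ (ι K M m)) : D₁ = D₂ := by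
  ext a
  induction a using SymmetricAlgebra.induction with
  | algebraMap r => simp
  | ι x => exact h x
  | mul a b ha hb => simp [ha, hb]
  | add a b ha hb => simp [ha, hb]

variable (K M) in
/-- The algebra homomorphism `Sym M → Sym M[X]` with `m ↦ m X`, which records the grading. -/
noncomputable def gradingHom : SymmetricAlgebra K M →ₐ[K] Polynomial (SymmetricAlgebra K M) :=
  lift ((Polynomial.monomial 1).restrictScalars K ∘ₗ ι K M)

@[simp]
theorem gradingHom_ι (m : M) : gradingHom K M (ι K M m) = Polynomial.monomial 1 (ι K M m) :=
  lift_ι_apply _ m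

/-- The homogeneous component of degree `d`. -/
noncomputable def component (d : ℕ) : SymmetricAlgebra K M →ₗ[K] SymmetricAlgebra K M :=
  (Polynomial.lcoeff (SymmetricAlgebra K M) d).restrictScalars K ∘ₗ (gradingHom K M).toLinearMap

theorem component_apply (d : ℕ) (f : SymmetricAlgebra K M) :
    component d f = (gradingHom K M f).coeff d := rfl

theorem gradingHom_of_mem {d : ℕ} {f : SymmetricAlgebra K M}
    (hf : f ∈ LinearMap.range (ι K M) ^ d) : gradingHom K M f = Polynomial.monomial d f := by
  induction d generalizing f with
  | zero =>
    rw [pow_zero, Submodule.mem_one] at hf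
    obtain ⟨r, rfl⟩ := hf
    rw [AlgHom.commutes]
    rfl
  | succ n ih =>
    rw [pow_succ] at hf
    refine Submodule.mul_induction_on hf (fun a ha b hb => ?_) (fun a b ha hb => ?_)
    · obtain ⟨m, rfl⟩ := hb
      rw [map_mul, ih ha, gradingHom_ι, Polynomial.monomial_mul_monomial]
    · rw [map_add, ha, hb, map_add]

theorem component_mul_of_mem {e : ℕ} {h : SymmetricAlgebra K M}
    (hh : h ∈ LinearMap.range (ι K M) ^ e) (d : ℕ) (g : SymmetricAlgebra K M) :
    component d (g * h) = if e ≤ d then component (d - e) g * h else 0 := by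
  rw [component_apply, map_mul, gradingHom_of_mem hh, ← Polynomial.C_mul_X_pow_eq_monomial,
    ← mul_assoc, Polynomial.coeff_mul_X_pow', Polynomial.coeff_mul_C]
  rfl

theorem component_of_mem {d : ℕ} {f : SymmetricAlgebra K M}
    (hf : f ∈ LinearMap.range (ι K M) ^ d) : component d f = f := by
  rw [component_apply, gradingHom_of_mem hf, Polynomial.coeff_monomial_same]

theorem component_mem (d : ℕ) (f : SymmetricAlgebra K M) :
    component d f ∈ LinearMap.range (ι K M) ^ d := by
  induction f using SymmetricAlgebra.induction generalizing d with
  | algebraMap r =>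
    have hr : algebraMap K (SymmetricAlgebra K M) r ∈ LinearMap.range (ι K M) ^ 0 := by
      rw [pow_zero]; exact Submodule.algebraMap_mem r
    rw [component_apply, gradingHom_of_mem hr, Polynomial.coeff_monomial]
    split_ifs with h
    · rwa [← h]
    · exact zero_mem _
  | ι x =>
    rw [component_apply, gradingHom_ι, Polynomial.coeff_monomial]
    split_ifs with h
    · rw [← h, pow_one]; exact ⟨x, rfl⟩
    · exact zero_mem _
  | mul a b ha hb =>
    rw [component_apply, map_mul, Polynomial.coeff_mul]
    refine sum_mem fun p hp => ?_
    rw [← Finset.HasAntidiagonal.mem_antidiagonal.1 hp, pow_add]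
    exact Submodule.mul_mem_mul (ha _) (hb _)
  | add a b ha hb => rw [map_add]; exact add_mem (ha _) (hb _)

/-- A basis of `M` maps `Sym M` to polynomials, where the coefficients of the degree one monomials
recover the coordinates. -/
theorem ι_injective : Function.Injective (ι K M) := by
  intro a b hab
  let b' := Module.Free.chooseBasis K M
  have h : ∀ m, lift (b'.constr K (MvPolynomial.X : _ → MvPolynomial _ K)) (ι K M m) =
      b'.constr K MvPolynomial.X m := fun m => lift_ι_apply _ m
  have hab' := congrArg (lift (b'.constr K (MvPolynomial.X : _ → MvPolynomial _ K))) hab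
  rw [h, h] at hab'
  apply b'.repr.injective
  ext i
  have := congrArg (MvPolynomial.coeff (Finsupp.single i 1)) hab'
  simpa [Module.Basis.constr_apply, Finsupp.sum, MvPolynomial.coeff_sum, MvPolynomial.coeff_X,
    Finsupp.single_left_inj, Finset.sum_ite_eq'] using this

theorem ι_ne_zero {m : M} (hm : m ≠ 0) : ι K M m ≠ 0 :=
  fun h => hm (ι_injective (h.trans (map_zero _).symm))

instance instUniqueFactorizationMonoid : UniqueFactorizationMonoid (SymmetricAlgebra K M) :=
  (equivMvPolynomial (Module.Free.chooseBasis K M)).toMulEquiv.symm.uniqueFactorizationMonoid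
    inferInstance

/-- The algebra homomorphism `Sym M → Sym N` induced by a linear map. -/
noncomputable def mapHom (p : M →ₗ[K] N) : SymmetricAlgebra K M →ₐ[K] SymmetricAlgebra K N :=
  lift (ι K N ∘ₗ p)

@[simp]
theorem mapHom_ι (p : M →ₗ[K] N) (m : M) : mapHom p (ι K M m) = ι K N (p m) :=
  lift_ι_apply _ m

theorem mapHom_mem (p : M →ₗ[K] N) {d : ℕ} {f : SymmetricAlgebra K M}
    (hf : f ∈ LinearMap.range (ι K M) ^ d) : mapHom p f ∈ LinearMap.range (ι K N) ^ d := by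
  have h := Submodule.mem_map_of_mem (f := (mapHom p).toLinearMap) hf
  rw [Submodule.map_pow] at h
  refine SetLike.le_def.1 (pow_le_pow_left' ?_ d) h
  rintro _ ⟨_, ⟨m, rfl⟩, rfl⟩
  exact ⟨p m, (mapHom_ι p m).symm⟩

theorem mapHom_mapHom_of_rightInverse {p : M →ₗ[K] N} {σ : N →ₗ[K] M}
    (h : ∀ n, p (σ n) = n) (f : SymmetricAlgebra K N) : mapHom p (mapHom σ f) = f := by
  have : (mapHom p).comp (mapHom σ) = AlgHom.id K _ := by
    apply algHom_ext; ext n; simp [h]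
  exact DFunLike.congr_fun this f

/-- With a linear section `σ` of `p`, every `f` is congruent to `σ(p(f))` modulo `a`; this holds on
generators and is preserved by sums and products. -/
theorem mapHom_eq_zero_iff {p : M →ₗ[K] N} (hp : Function.Surjective p) {a : M}
    (ha : LinearMap.ker p = K ∙ a) (f : SymmetricAlgebra K M) :
    mapHom p f = 0 ↔ ι K M a ∣ f := by
  obtain ⟨σ, hσ⟩ := p.exists_rightInverse_of_surjective (LinearMap.range_eq_top.2 hp)
  have hσ' : ∀ n, p (σ n) = n := fun n => DFunLike.congr_fun hσ n
  have key : ∀ f, ι K M a ∣ f - mapHom σ (mapHom p f) := by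
    intro f
    induction f using SymmetricAlgebra.induction with
    | algebraMap r => simp
    | ι x =>
      have hx : x - σ (p x) ∈ LinearMap.ker p := by simp [hσ']
      rw [ha, Submodule.mem_span_singleton] at hx
      obtain ⟨c, hc⟩ := hx
      rw [mapHom_ι, mapHom_ι, ← map_sub, ← hc, map_smul]
      exact Dvd.intro_left (algebraMap K _ c) (by rw [Algebra.smul_def])
    | mul x y hx hy =>
      rw [map_mul, map_mul]
      have : x * y - mapHom σ (mapHom p x) * mapHom σ (mapHom p y) =
        (x - mapHom σ (mapHom p x)) * y + mapHom σ (mapHom p x) * (y - mapHom σ (mapHom p y)) := by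
        ring
      rw [this]
      exact dvd_add (hx.mul_right _) (hy.mul_left _)
    | add x y hx hy =>
      rw [map_add, map_add, add_sub_add_comm]
      exact dvd_add hx hy
  constructor
  · intro h
    simpa [h] using key f
  · rintro ⟨g, rfl⟩
    have : p a = 0 := by
      rw [← LinearMap.mem_ker, ha]; exact Submodule.mem_span_singleton_self a
    simp [this]

/-- Divisibility by `a` is the vanishing of the image in `Sym (M / a)`, which is a domain. -/
theorem prime_ι {a : M} (ha : a ≠ 0) : Prime (ι K M a) := by
  have h := mapHom_eq_zero_iff (K := K) (Submodule.mkQ_surjective (K ∙ a)) (a := a)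
    (Submodule.ker_mkQ _)
  refine ⟨ι_ne_zero ha, fun hu => ?_, fun x y hxy => ?_⟩
  · have := (h 1).2 (isUnit_iff_dvd_one.1 hu)
    simp at this
  · rw [← h, map_mul, mul_eq_zero, h, h] at hxy
    exact hxy

theorem exists_smul_of_ι_dvd {a b : M} (h : ι K M a ∣ ι K M b) : ∃ c : K, b = c • a := by
  have h' := (mapHom_eq_zero_iff (Submodule.mkQ_surjective (K ∙ a)) (Submodule.ker_mkQ _) _).2 h
  rw [mapHom_ι] at h'
  have h2 := ι_injective (h'.trans (map_zero _).symm)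
  rw [← LinearMap.mem_ker, Submodule.ker_mkQ, Submodule.mem_span_singleton] at h2
  exact h2.imp fun c hc => hc.symm

end SymmetricAlgebra

/-- Rank arguments control how many exponents are at most `k`; these cumulative counts determine the
multiset. -/
theorem Multiset.eq_of_countP_le {E F : Multiset ℕ}
    (h : ∀ k, E.countP (· ≤ k) = F.countP (· ≤ k)) : E = F := by
  have key : ∀ (G : Multiset ℕ) (k : ℕ),
      G.countP (· ≤ k + 1) = G.countP (· ≤ k) + G.count (k + 1) := by
    intro G k
    induction G using Multiset.induction with
    | empty => simp
    | cons a G ih =>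
      simp only [Multiset.countP_cons, Multiset.count_cons, ih]
      split_ifs <;> omega
  have key0 : ∀ G : Multiset ℕ, G.countP (· ≤ 0) = G.count 0 := by
    intro G
    rw [Multiset.count]
    exact Multiset.countP_congr rfl fun x _ => by
      rw [Nat.le_zero]; exact propext eq_comm
  ext k
  cases k with
  | zero => rw [← key0, ← key0, h]
  | succ k =>
    have := h (k + 1)
    rw [key, key, h k] at this
    omega

theorem Finset.countP_univ_map {ι : Type*} [Fintype ι] (d : ι → ℕ) (p : ℕ → Prop)
    [DecidablePred p] :
    (Finset.univ.val.map d).countP p = Fintype.card {i // p (d i)} := by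
  rw [Multiset.countP_map, Fintype.card_subtype]
  rfl

/-! ### Uniqueness of exponents and the empty arrangement -/

namespace HyperplaneArrangement

section Derivations

open SymmetricAlgebra

variable {K : Type u} [Field K] {V : Type v} [AddCommGroup V] [Module K V]

local notation "Sym" => SymmetricAlgebra K (Module.Dual K V)
local notation "Der" => Derivation K Sym Sym

theorem derivation_finset_sum_apply {ι : Type*} (s : Finset ι) (g : ι → Sym) (ψ : ι → Der)
    (a : Sym) : (∑ j ∈ s, g j • ψ j) a = ∑ j ∈ s, g j * ψ j a := by
  classical
  induction s using Finset.induction with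
  | empty => simp
  | insert i s hi ih => rw [Finset.sum_insert hi, Finset.sum_insert hi, Derivation.add_apply, ih,
      Derivation.smul_apply, smul_eq_mul]

/-- Replacing each `g j` by its component of degree `d - e j` (zero if `d < e j`) does not change
the homogeneous sum, so independence makes `g j` equal to that component. -/
theorem coeff_eq_zero_of_lt {ι : Type*} [Fintype ι] {ψ : ι → Der}
    (hli : LinearIndependent Sym ψ) {e : ι → ℕ} (hψ : ∀ j, IsHomogeneousDerivation (ψ j) (e j))
    {d : ℕ} {g : ι → Sym} (hθ : IsHomogeneousDerivation (∑ j, g j • ψ j) d) {j : ι}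
    (hj : d < e j) : g j = 0 := by
  let g' : ι → Sym := fun j => if e j ≤ d then component (d - e j) (g j) else 0
  have h : ∑ j, g j • ψ j = ∑ j, g' j • ψ j := by
    apply derivation_ext
    intro α
    rw [← component_of_mem (hθ α), derivation_finset_sum_apply, derivation_finset_sum_apply,
      map_sum]
    refine Finset.sum_congr rfl fun j _ => ?_
    rw [component_mul_of_mem (hψ j α)]
    simp only [g']
    split_ifs <;> simp
  have h2 : ∑ j, (g j - g' j) • ψ j = 0 := by
    rw [← sub_eq_zero, ← Finset.sum_sub_distrib] at h
    rw [← h]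
    exact Finset.sum_congr rfl fun j _ => sub_smul (R := Sym) (M := Der) _ _ _
  have h3 := Fintype.linearIndependent_iff.1 hli _ h2 j
  rw [sub_eq_zero] at h3
  rw [h3]
  exact if_neg (not_le.2 hj)

/-- By degrees, the `θ i` already lie in the span of the `ψ j` with `e j ≤ k`, and an independent
family is no larger than a finite spanning set. -/
theorem card_le_of_linearIndependent {ι κ : Type*} [Fintype ι] [Fintype κ] {θ : ι → Der}
    (hθ : LinearIndependent Sym θ) {d : ι → ℕ} (hd : ∀ i, IsHomogeneousDerivation (θ i) (d i))
    {k : ℕ} (hk : ∀ i, d i ≤ k) {ψ : κ → Der} (hψ : LinearIndependent Sym ψ) {e : κ → ℕ}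
    (he : ∀ j, IsHomogeneousDerivation (ψ j) (e j))
    (hmem : ∀ i, θ i ∈ Submodule.span Sym (Set.range ψ)) :
    Fintype.card ι ≤ Fintype.card {j // e j ≤ k} := by
  classical
  let w : Set Der := Set.range fun j : {j // e j ≤ k} => ψ j
  have hw : Set.range θ ≤ Submodule.span Sym w := by
    rintro _ ⟨i, rfl⟩
    obtain ⟨g, hg⟩ := (Submodule.mem_span_range_iff_exists_fun _).1 (hmem i)
    rw [SetLike.mem_coe, ← hg]
    refine Submodule.sum_mem _ fun j _ => ?_
    by_cases hj : e j ≤ k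
    · exact Submodule.smul_mem _ _ (Submodule.subset_span ⟨⟨j, hj⟩, rfl⟩)
    · rw [coeff_eq_zero_of_lt hψ he (g := g) (j := j) (by rw [hg]; exact hd i)
        (lt_of_le_of_lt (hk i) (not_le.1 hj)), zero_smul]
      exact zero_mem _
  have : Fintype w := Set.fintypeRange _
  exact (linearIndependent_le_span_aux' θ hθ w hw).trans (Fintype.card_range_le _)

theorem isFreeWithExponents_of_linearIndependent {A : HyperplaneArrangement K V} {ι : Type*}
    [Fintype ι] {θ : ι → Der} {d : ι → ℕ} (hli : LinearIndependent Sym θ)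
    (hspan : Submodule.span Sym (Set.range θ) = A.derivationModule)
    (hd : ∀ i, IsHomogeneousDerivation (θ i) (d i)) :
    A.IsFreeWithExponents (Finset.univ.val.map d) := by
  let e := Fintype.equivFin ι
  let b := ((Module.Basis.span hli).map (LinearEquiv.ofEq _ _ hspan)).reindex e
  refine ⟨_, b, d ∘ e.symm, fun i => ?_, ?_⟩
  · have : (b i).1 = θ (e.symm i) := by
      simp [b, Module.Basis.span_apply]
    rw [this]
    exact hd _
  · rw [← Multiset.map_map]
    congr 1
    have := congrArg Finset.val (Finset.map_univ_equiv e.symm)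
    rw [Finset.map_val] at this
    exact this.symm

theorem IsFreeWithExponents.exists_linearIndependent {A : HyperplaneArrangement K V}
    {E : Multiset ℕ} (h : A.IsFreeWithExponents E) :
    ∃ (n : ℕ) (θ : Fin n → Der) (d : Fin n → ℕ), LinearIndependent Sym θ ∧
      Submodule.span Sym (Set.range θ) = A.derivationModule ∧
      (∀ i, IsHomogeneousDerivation (θ i) (d i)) ∧ E = Finset.univ.val.map d := by
  obtain ⟨n, b, d, hd, hE⟩ := h
  refine ⟨n, fun i => (b i).1, d, ?_, ?_, hd, hE⟩
  · exact b.linearIndependent.map_injOn A.derivationModule.subtype Subtype.val_injective.injOn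
  · have : Set.range (fun i => (b i).1) = A.derivationModule.subtype '' Set.range b := by
      rw [← Set.range_comp]; rfl
    rw [this, Submodule.span_image, b.span_eq, Submodule.map_top, Submodule.range_subtype]

theorem IsFreeWithExponents.countP_le {A : HyperplaneArrangement K V} {E F : Multiset ℕ}
    (hE : A.IsFreeWithExponents E) (hF : A.IsFreeWithExponents F) (k : ℕ) :
    E.countP (· ≤ k) ≤ F.countP (· ≤ k) := by
  obtain ⟨n, θ, d, hli, hs, hd, rfl⟩ := hE.exists_linearIndependent
  obtain ⟨n', ψ, e, hli', hs', he, rfl⟩ := hF.exists_linearIndependent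
  rw [Finset.countP_univ_map, Finset.countP_univ_map]
  refine card_le_of_linearIndependent (θ := fun i : {i // d i ≤ k} => θ i)
    (hli.comp _ Subtype.val_injective) (d := fun i => d i) (fun i => hd i) (fun i => i.2) hli' he
    fun i => ?_
  rw [hs', ← hs]
  exact Submodule.subset_span ⟨i, rfl⟩

/-- The exponents of a free arrangement are well defined. -/
theorem IsFreeWithExponents.unique {A : HyperplaneArrangement K V} {E F : Multiset ℕ}
    (hE : A.IsFreeWithExponents E) (hF : A.IsFreeWithExponents F) : E = F :=
  Multiset.eq_of_countP_le fun k => le_antisymm (hE.countP_le hF k) (hF.countP_le hE k)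

/-- The derivation module of the empty arrangement has a basis of derivations of degree zero. -/
theorem isFreeWithExponents_empty [FiniteDimensional K V] :
    (empty K V).IsFreeWithExponents (Multiset.replicate (Module.finrank K V) 0) := by
  let b := Module.finBasis K (Module.Dual K V)
  choose θ hθ using fun i => exists_derivation
    (b.constr K (Pi.single i (1 : Sym) : Fin (Module.finrank K (Module.Dual K V)) → Sym))
  have hθ' : ∀ i j, θ i (ι K _ (b j)) = if j = i then 1 else 0 := by
    intro i j
    rw [hθ, Module.Basis.constr_basis, Pi.single_apply]
  have hcomb : ∀ (g : Fin (Module.finrank K (Module.Dual K V)) → Sym) j,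
      (∑ i, g i • θ i) (ι K _ (b j)) = g j := by
    intro g j
    simp [derivation_finset_sum_apply, hθ']
  have hrep : ∀ η : Der, ∑ i, η (ι K _ (b i)) • θ i = η := by
    intro η
    apply derivation_ext
    have : (∑ i, η (ι K _ (b i)) • θ i).toLinearMap ∘ₗ ι K _ = η.toLinearMap ∘ₗ ι K _ :=
      b.ext fun j => hcomb _ j
    exact fun m => DFunLike.congr_fun this m
  have h := isFreeWithExponents_of_linearIndependent (A := empty K V) (θ := θ) (d := fun _ => 0)
    (Fintype.linearIndependent_iff.2 fun g hg j => by
      rw [← hcomb g j, hg]; rfl)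
    (by
      have htop : (empty K V).derivationModule = ⊤ := by
        rw [eq_top_iff]
        exact fun η _ H hH => hH.elim
      rw [htop, eq_top_iff]
      intro η _
      rw [← hrep η]
      exact Submodule.sum_mem _ fun i _ => Submodule.smul_mem _ _ (Submodule.subset_span ⟨i, rfl⟩))
    (fun i α => by
      rw [pow_zero, hθ, Module.Basis.constr_apply_fintype]
      refine Submodule.sum_mem _ fun j _ => Submodule.smul_mem _ _ ?_
      rw [Pi.single_apply]
      split_ifs
      · exact Submodule.one_le.1 le_rfl
      · exact zero_mem _)
  have hE : (Finset.univ : Finset (Fin (Module.finrank K (Module.Dual K V)))).val.map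
      (fun _ => 0) = Multiset.replicate (Module.finrank K V) 0 := by
    rw [Multiset.map_const', Finset.card_val, Finset.card_univ, Fintype.card_fin,
      Subspace.dual_finrank_eq]
  rwa [hE] at h

/-! ### Restricting forms and derivations to a hyperplane -/

theorem exists_eq_smul_of_ker_le {α β : Module.Dual K V} (h : LinearMap.ker α ≤ LinearMap.ker β) :
    ∃ c : K, β = c • α := by
  by_cases hα : α = 0
  · subst hα
    rw [LinearMap.ker_zero, top_le_iff, LinearMap.ker_eq_top] at h
    exact ⟨0, by simp [h]⟩
  · obtain ⟨v, hv⟩ := DFunLike.ne_iff.1 hα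
    rw [LinearMap.zero_apply] at hv
    refine ⟨β v / α v, LinearMap.ext fun x => ?_⟩
    have hx : x - (α x / α v) • v ∈ LinearMap.ker α := by simp [hv]
    have := h hx
    rw [LinearMap.mem_ker, map_sub, map_smul, sub_eq_zero] at this
    rw [this, LinearMap.smul_apply, smul_eq_mul, smul_eq_mul]
    field_simp

theorem exists_eq_smul_of_ker_eq {α β : Module.Dual K V} (hα : α ≠ 0)
    (h : LinearMap.ker α = LinearMap.ker β) : ∃ c : K, c ≠ 0 ∧ β = c • α := by
  obtain ⟨c, rfl⟩ := exists_eq_smul_of_ker_le h.le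
  refine ⟨c, ?_, rfl⟩
  rintro rfl
  rw [zero_smul, LinearMap.ker_zero, LinearMap.ker_eq_top] at h
  exact hα h

theorem ne_zero_of_isCoatom_ker {α : Module.Dual K V} (h : IsCoatom (LinearMap.ker α)) :
    α ≠ 0 := by
  rintro rfl
  exact h.1 LinearMap.ker_zero

theorem exists_ker_eq {H : Submodule K V} (h : IsCoatom H) :
    ∃ α : Module.Dual K V, LinearMap.ker α = H := by
  obtain ⟨v, hv⟩ : ∃ v, v ∉ H := by
    by_contra! hcon
    exact h.1 (eq_top_iff.2 fun x _ => hcon x)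
  obtain ⟨α, hα, hle⟩ := Submodule.exists_le_ker_of_notMem hv
  refine ⟨α, ((h.le_iff.1 hle).resolve_left fun htop => hα ?_)⟩
  rw [LinearMap.ker_eq_top.1 htop, LinearMap.zero_apply]

theorem ker_dualRestrict_ker (α : Module.Dual K V) :
    LinearMap.ker (LinearMap.ker α).dualRestrict = K ∙ α := by
  ext β
  rw [LinearMap.mem_ker, Submodule.mem_span_singleton]
  constructor
  · intro h
    obtain ⟨c, hc⟩ := exists_eq_smul_of_ker_le (α := α) (β := β) fun x hx => by
      have hx' := DFunLike.congr_fun h (⟨x, hx⟩ : LinearMap.ker α)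
      exact hx'
    exact ⟨c, hc.symm⟩
  · rintro ⟨c, rfl⟩
    ext x
    have := x.2
    rw [LinearMap.mem_ker] at this
    simp [this]

/-- The homomorphism `Sym(V*) → Sym(H*)` given by restricting linear forms to `H`. -/
noncomputable abbrev symRestrict (H : Submodule K V) :
    SymmetricAlgebra K (Module.Dual K V) →ₐ[K] SymmetricAlgebra K (Module.Dual K H) :=
  mapHom H.dualRestrict

theorem symRestrict_eq_zero_iff {H : Submodule K V} {α : Module.Dual K V}
    (hα : LinearMap.ker α = H) (f : Sym) : symRestrict H f = 0 ↔ ι K _ α ∣ f := by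
  subst hα
  exact mapHom_eq_zero_iff Subspace.dualRestrict_surjective (ker_dualRestrict_ker α) f

/-- A linear splitting of `V* → H*` induces `s`. It is used to lift coefficients found on `H`
without changing their degrees. -/
theorem exists_symRestrict_eq (H : Submodule K V) :
    ∃ s : SymmetricAlgebra K (Module.Dual K H) →ₐ[K] SymmetricAlgebra K (Module.Dual K V),
      (∀ f, symRestrict H (s f) = f) ∧
      ∀ d f, f ∈ LinearMap.range (ι K (Module.Dual K H)) ^ d →
        s f ∈ LinearMap.range (ι K (Module.Dual K V)) ^ d := by
  obtain ⟨σ, hσ⟩ := H.dualRestrict.exists_rightInverse_of_surjective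
    (LinearMap.range_eq_top.2 Subspace.dualRestrict_surjective)
  exact ⟨mapHom σ, mapHom_mapHom_of_rightInverse (fun n => DFunLike.congr_fun hσ n),
    fun _ _ => mapHom_mem σ⟩

theorem mem_derivationModule_iff {A : HyperplaneArrangement K V} {H₀ : Submodule K V}
    (hA : H₀ ∈ A.hyperplanes) {α₀ : Module.Dual K V} (hα₀ : LinearMap.ker α₀ = H₀) {θ : Der} :
    θ ∈ A.derivationModule ↔
      θ ∈ (A.deletion H₀).derivationModule ∧ ι K _ α₀ ∣ θ (ι K _ α₀) := by
  constructor
  · exact fun h => ⟨fun H hH => h H hH.1, h H₀ hA α₀ hα₀⟩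
  · rintro ⟨h1, h2⟩ H hH α hα
    by_cases hH₀ : H = H₀
    · subst hH₀
      obtain ⟨c, hc, rfl⟩ := exists_eq_smul_of_ker_eq
        (ne_zero_of_isCoatom_ker (hα₀ ▸ A.isCoatom _ hA)) (hα₀.trans hα.symm)
      rw [map_smul, Derivation.map_smul]
      obtain ⟨g, hg⟩ := h2
      exact ⟨g, by rw [hg, smul_mul_assoc]⟩
    · exact h1 H ⟨hH, hH₀⟩ α hα

theorem exists_eq_smul_of_forall_dvd {a : Sym} (ha : a ≠ 0) {θ : Der}
    (h : ∀ α, a ∣ θ (ι K _ α)) : ∃ η : Der, θ = a • η := by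
  choose φ hφ using h
  obtain ⟨η, hη⟩ := exists_derivation (K := K) (M := Module.Dual K V)
    { toFun := φ
      map_add' := fun x y => mul_left_cancel₀ ha (by
        rw [mul_add, ← hφ, ← hφ, ← hφ, map_add, map_add])
      map_smul' := fun c x => mul_left_cancel₀ ha (by
        rw [RingHom.id_apply, mul_smul_comm, ← hφ, ← hφ, map_smul, Derivation.map_smul]) }
  refine ⟨η, derivation_ext fun m => ?_⟩
  rw [Derivation.smul_apply, hη]
  exact hφ m

/-- Derivations in `D(A)` restrict to derivations in `D(A'')`. -/
theorem exists_restriction {A : HyperplaneArrangement K V} {H₀ : Submodule K V}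
    (hA : H₀ ∈ A.hyperplanes) {θ : Der} (hθ : θ ∈ A.derivationModule) :
    ∃ η ∈ (A.restriction H₀).derivationModule, ∀ α,
      η (ι K _ (H₀.dualRestrict α)) = symRestrict H₀ (θ (ι K _ α)) := by
  obtain ⟨α₀, hα₀⟩ := exists_ker_eq (A.isCoatom _ hA)
  obtain ⟨σ, hσ⟩ := H₀.dualRestrict.exists_rightInverse_of_surjective
    (LinearMap.range_eq_top.2 Subspace.dualRestrict_surjective)
  obtain ⟨η, hη⟩ := exists_derivation (K := K) (M := Module.Dual K H₀)
    ((symRestrict H₀).toLinearMap ∘ₗ θ.toLinearMap ∘ₗ ι K _ ∘ₗ σ)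
  have key : ∀ α, η (ι K _ (H₀.dualRestrict α)) = symRestrict H₀ (θ (ι K _ α)) := by
    intro α
    rw [hη]
    change symRestrict H₀ (θ (ι K _ (σ (H₀.dualRestrict α)))) = _
    -- Independence of the chosen lift: two lifts differ by a multiple of `α₀`, and `θ(α₀)` vanishes
    -- on `H₀`.
    have hmem : α - σ (H₀.dualRestrict α) ∈ LinearMap.ker H₀.dualRestrict := by
      rw [LinearMap.mem_ker, map_sub, sub_eq_zero]
      exact (DFunLike.congr_fun hσ (H₀.dualRestrict α)).symm
    subst hα₀
    rw [ker_dualRestrict_ker, Submodule.mem_span_singleton] at hmem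
    obtain ⟨c, hc⟩ := hmem
    have h2 : θ (ι K _ α) - θ (ι K _ (σ ((LinearMap.ker α₀).dualRestrict α))) =
        c • θ (ι K _ α₀) := by
      rw [← Derivation.map_sub, ← map_sub, ← hc, map_smul, Derivation.map_smul]
    have h3 : symRestrict (LinearMap.ker α₀) (θ (ι K _ α₀)) = 0 :=
      (symRestrict_eq_zero_iff rfl _).2 (hθ _ hA α₀ rfl)
    have h4 := congrArg (symRestrict (LinearMap.ker α₀)) h2
    rw [map_sub, map_smul, h3, smul_zero, sub_eq_zero] at h4
    exact h4.symm
  refine ⟨η, ?_, key⟩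
  rintro _ ⟨H, ⟨hH, hle⟩, rfl⟩ β hβ
  obtain ⟨α, hα⟩ := exists_ker_eq (A.isCoatom _ hH)
  have hker : LinearMap.ker (H₀.dualRestrict α) = interIn H₀ H := by
    rw [← hα]; rfl
  have hco : IsCoatom (LinearMap.ker (H₀.dualRestrict α)) :=
    hker ▸ isCoatom_interIn (A.isCoatom _ hH) hle
  obtain ⟨c, hc, rfl⟩ := exists_eq_smul_of_ker_eq (ne_zero_of_isCoatom_ker hco)
    (hker.trans hβ.symm)
  rw [← map_smul, key, ← mapHom_ι]
  refine map_dvd (symRestrict H₀) (hθ H hH _ ?_)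
  rw [LinearMap.ker_smul _ _ hc, hα]

/-- A relation on `H₀` lifts to a combination of the `θ i` of the form `α₀ η`. Since `α₀` is coprime
to the forms of `A'`, also `η ∈ D(A')`, so all lifted coefficients are divisible by `α₀` and vanish
on `H₀`. -/
theorem symRestrict_linearIndependent {A : HyperplaneArrangement K V} {H₀ : Submodule K V}
    (hA : H₀ ∈ A.hyperplanes) {ι' : Type*} [Fintype ι'] {θ : ι' → Der}
    (hli : LinearIndependent Sym θ)
    (hspan : Submodule.span Sym (Set.range θ) = (A.deletion H₀).derivationModule) :
    LinearIndependent (SymmetricAlgebra K (Module.Dual K H₀))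
      (fun i (α : Module.Dual K V) => symRestrict H₀ (θ i (ι K _ α))) := by
  obtain ⟨α₀, hα₀⟩ := exists_ker_eq (A.isCoatom _ hA)
  have hα₀' : α₀ ≠ 0 := ne_zero_of_isCoatom_ker (hα₀ ▸ A.isCoatom _ hA)
  obtain ⟨s, hs, -⟩ := exists_symRestrict_eq H₀
  refine Fintype.linearIndependent_iff.2 fun c hc i => ?_
  have hdvd : ∀ α, ι K _ α₀ ∣ (∑ i, s (c i) • θ i) (ι K _ α) := by
    intro α
    rw [← symRestrict_eq_zero_iff hα₀, derivation_finset_sum_apply, map_sum]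
    have := congrFun hc α
    rw [Finset.sum_apply] at this
    refine Eq.trans (Finset.sum_congr rfl fun i _ => ?_) this
    rw [map_mul, hs]
    rfl
  obtain ⟨η, hη⟩ := exists_eq_smul_of_forall_dvd (ι_ne_zero hα₀') hdvd
  have hηmem : η ∈ (A.deletion H₀).derivationModule := by
    rintro H hH α hα
    have hmem : ∑ i, s (c i) • θ i ∈ (A.deletion H₀).derivationModule := by
      rw [← hspan]
      exact Submodule.sum_mem _ fun i _ => Submodule.smul_mem _ _ (Submodule.subset_span ⟨i, rfl⟩)
    have h1 := hmem H hH α hα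
    rw [hη, Derivation.smul_apply, smul_eq_mul] at h1
    have hα' : α ≠ 0 := ne_zero_of_isCoatom_ker (hα ▸ A.isCoatom _ hH.1)
    refine ((prime_ι hα').dvd_or_dvd h1).resolve_left fun h2 => hH.2 ?_
    obtain ⟨t, ht⟩ := exists_smul_of_ι_dvd h2
    have ht0 : t ≠ 0 := by
      rintro rfl
      exact hα₀' (by rw [ht, zero_smul])
    rw [Set.mem_singleton_iff, ← hα, ← hα₀, ht, LinearMap.ker_smul _ _ ht0]
  rw [← hspan] at hηmem
  obtain ⟨g, rfl⟩ := (Submodule.mem_span_range_iff_exists_fun _).1 hηmem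
  have h2 : s (c i) = ι K _ α₀ * g i := by
    have h3 : ∑ i, s (c i) • θ i = ∑ i, (ι K _ α₀ * g i) • θ i := by
      rw [hη, Finset.smul_sum]
      exact Finset.sum_congr rfl fun i _ => smul_smul _ _ _
    exact Fintype.linearIndependent_iffₛ.1 hli _ _ h3 i
  rw [← hs (c i), symRestrict_eq_zero_iff hα₀, h2]
  exact dvd_mul_right _ _

/-! ### The addition theorem -/

theorem exists_eq_component_mul {M : Type w} [AddCommGroup M] [Module K M]
    {q f : SymmetricAlgebra K M} {m d : ℕ} (hq : q ∈ LinearMap.range (ι K M) ^ m)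
    (hf : f ∈ LinearMap.range (ι K M) ^ d) (h : q ∣ f) :
    ∃ g, f = g * q ∧ (m ≤ d → g ∈ LinearMap.range (ι K M) ^ (d - m)) ∧ (d < m → g = 0) := by
  obtain ⟨g, rfl⟩ := h
  rw [mul_comm] at hf
  have h1 := component_mul_of_mem hq d g
  rw [component_of_mem hf] at h1
  by_cases hmd : m ≤ d
  · rw [if_pos hmd] at h1
    exact ⟨_, (mul_comm _ _).trans h1, fun _ => component_mem _ _, fun h => absurd hmd (not_le.2 h)⟩
  · rw [if_neg hmd] at h1
    exact ⟨0, by rw [zero_mul, mul_comm, h1], fun h => absurd h hmd, fun _ => rfl⟩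

/-- The basis elements counted on the left restrict to derivations in `D(A'')` of the same degrees,
and these remain independent. -/
theorem card_filter_degree_le {A : HyperplaneArrangement K V} {H₀ : Submodule K V}
    (hA : H₀ ∈ A.hyperplanes) {E : Multiset ℕ} (hE : (A.restriction H₀).IsFreeWithExponents E)
    {ι' : Type*} [Fintype ι'] {θ : ι' → Der}
    (hli : LinearIndependent Sym θ)
    (hspan : Submodule.span Sym (Set.range θ) = (A.deletion H₀).derivationModule)
    {d : ι' → ℕ} (hd : ∀ i, IsHomogeneousDerivation (θ i) (d i)) {k : ℕ}
    (hk : ∀ i, d i ≤ k → θ i ∈ A.derivationModule) :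
    Fintype.card {i // d i ≤ k} ≤ E.countP (· ≤ k) := by
  obtain ⟨n, ψ, e, hψ, hψs, he, rfl⟩ := hE.exists_linearIndependent
  rw [Finset.countP_univ_map]
  choose η hη hηθ using fun i : {i // d i ≤ k} => exists_restriction hA (hk i i.2)
  refine card_le_of_linearIndependent (θ := η) (d := fun i => d i) ?_ ?_ (fun i => i.2) hψ he ?_
  · have h1 := (symRestrict_linearIndependent hA hli hspan).comp
      (Subtype.val : {i // d i ≤ k} → ι') Subtype.val_injective
    refine Fintype.linearIndependent_iff.2 fun c hc i => ?_
    refine Fintype.linearIndependent_iff.1 h1 c ?_ i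
    funext α
    rw [Finset.sum_apply]
    have h2 : (∑ i, c i • η i) (ι K _ (H₀.dualRestrict α)) = 0 := by rw [hc]; rfl
    rw [derivation_finset_sum_apply] at h2
    refine Eq.trans (Finset.sum_congr rfl fun i _ => ?_) h2
    rw [hηθ]
    rfl
  · intro i β
    obtain ⟨α, rfl⟩ := (Subspace.dualRestrict_surjective (W := H₀)) β
    rw [hηθ]
    exact mapHom_mem _ (hd i α)
  · intro i
    rw [hψs]
    exact hη i

/-- Elimination with the pivot `θ l`: on `H₀` one has `θ i (α₀) = f i * θ l (α₀)`, so each `θ i - f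
i • θ l` with `i ≠ l` is tangent to `H₀`. Together with `α₀ • θ l` these form a basis of `D(A)`. -/
theorem isFreeWithExponents_of_exists {A : HyperplaneArrangement K V} {H₀ : Submodule K V}
    (hA : H₀ ∈ A.hyperplanes) {α₀ : Module.Dual K V} (hα₀ : LinearMap.ker α₀ = H₀)
    {ι' : Type*} [Fintype ι'] [DecidableEq ι'] {θ : ι' → Der}
    (hli : LinearIndependent Sym θ)
    (hspan : Submodule.span Sym (Set.range θ) = (A.deletion H₀).derivationModule)
    {d : ι' → ℕ} (hd : ∀ i, IsHomogeneousDerivation (θ i) (d i)) (l : ι')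
    (hl : symRestrict H₀ (θ l (ι K _ α₀)) ≠ 0)
    (hdvd : ∀ i, symRestrict H₀ (θ l (ι K _ α₀)) ∣ symRestrict H₀ (θ i (ι K _ α₀))) :
    A.IsFreeWithExponents (Finset.univ.val.map (Function.update d l (d l + 1))) := by
  have hα₀' : α₀ ≠ 0 := ne_zero_of_isCoatom_ker (hα₀ ▸ A.isCoatom _ hA)
  have hθmem : ∀ i, θ i ∈ (A.deletion H₀).derivationModule := fun i => by
    rw [← hspan]; exact Submodule.subset_span ⟨i, rfl⟩
  obtain ⟨s, hs, hsd⟩ := exists_symRestrict_eq H₀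
  obtain ⟨f, hf, hfl, hfd⟩ : ∃ f : ι' → Sym,
      (∀ i, symRestrict H₀ (θ i (ι K _ α₀)) =
        symRestrict H₀ (f i) * symRestrict H₀ (θ l (ι K _ α₀))) ∧ f l = 1 ∧
      ∀ i, IsHomogeneousDerivation (f i • θ l) (d i) := by
    choose g hg hgd hg0 using fun i => exists_eq_component_mul
      (mapHom_mem H₀.dualRestrict (hd l α₀))
      (mapHom_mem H₀.dualRestrict (hd i α₀)) (hdvd i)
    refine ⟨Function.update (fun i => s (g i)) l 1, fun i => ?_, Function.update_self .., ?_⟩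
    · by_cases hi : i = l
      · subst hi
        rw [Function.update_self, map_one, one_mul]
      · rw [Function.update_of_ne hi, hs]
        exact hg i
    · intro i α
      by_cases hi : i = l
      · subst hi
        rw [Function.update_self, one_smul]
        exact hd i α
      · rw [Function.update_of_ne hi, Derivation.smul_apply, smul_eq_mul]
        rcases le_or_gt (d l) (d i) with hle | hlt
        · have h1 := Submodule.mul_mem_mul (hsd _ _ (hgd i hle)) (hd l α)
          rwa [← pow_add, Nat.sub_add_cancel hle] at h1
        · rw [hg0 i hlt, map_zero, zero_mul]
          exact zero_mem _
  let θ' : ι' → Der := fun i => if i = l then ι K _ α₀ • θ l else θ i - f i • θ l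
  -- Since `f l = 1`, the coefficient of `θ l` on the right is `g l * α₀` minus the sum of `g j * f
  -- j` over `j ≠ l`.
  have hcomb : ∀ g : ι' → Sym, ∑ i, g i • θ' i =
      ∑ i, (g i + if i = l then g l * ι K _ α₀ - ∑ j, g j * f j else 0) • θ i := by
    intro g
    apply derivation_ext
    intro α
    have h1 : ∀ i, g i * θ' i (ι K _ α) = g i * θ i (ι K _ α) - (g i * f i) * θ l (ι K _ α) +
        if i = l then g l * ι K _ α₀ * θ l (ι K _ α) else 0 := by
      intro i
      by_cases hi : i = l
      · subst hi
        simp only [θ', if_true, Derivation.smul_apply, smul_eq_mul, hfl]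
        ring
      · simp only [θ', if_neg hi, Derivation.sub_apply, Derivation.smul_apply, smul_eq_mul]
        ring
    rw [derivation_finset_sum_apply, derivation_finset_sum_apply,
      Finset.sum_congr rfl fun i _ => h1 i]
    simp only [add_mul, ite_mul, zero_mul, Finset.sum_add_distrib, Finset.sum_sub_distrib,
      Finset.sum_ite_eq', Finset.mem_univ, if_true, sub_mul, Finset.sum_mul]
    ring
  refine isFreeWithExponents_of_linearIndependent (θ := θ') ?_ ?_ ?_
  · refine Fintype.linearIndependent_iff.2 fun g hg => ?_
    rw [hcomb] at hg
    have h1 := Fintype.linearIndependent_iff.1 hli _ hg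
    have h2 : ∀ i, i ≠ l → g i = 0 := fun i hi => by simpa [hi] using h1 i
    have h3 : g l = 0 := by
      have h4 := h1 l
      rw [if_pos rfl, Finset.sum_eq_single l (fun i _ hi => by rw [h2 i hi, zero_mul])
        (fun h => absurd (Finset.mem_univ l) h), hfl, mul_one, add_sub_cancel, mul_eq_zero] at h4
      exact h4.resolve_right (ι_ne_zero hα₀')
    intro i
    by_cases hi : i = l
    · rw [hi, h3]
    · exact h2 i hi
  · apply le_antisymm
    · rw [Submodule.span_le]
      rintro _ ⟨i, rfl⟩
      rw [SetLike.mem_coe, mem_derivationModule_iff hA hα₀]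
      by_cases hi : i = l
      · simp only [θ', if_pos hi]
        exact ⟨Submodule.smul_mem _ _ (hθmem l), by
          rw [Derivation.smul_apply, smul_eq_mul]; exact dvd_mul_right _ _⟩
      · simp only [θ', if_neg hi]
        refine ⟨?_, ?_⟩
        · exact Submodule.sub_mem (R := Sym) (M := Der) _ (hθmem i)
            (Submodule.smul_mem _ _ (hθmem l))
        · rw [← symRestrict_eq_zero_iff hα₀, Derivation.sub_apply, Derivation.smul_apply,
            smul_eq_mul, map_sub, map_mul, ← hf i, sub_self]
    · intro η hη
      rw [mem_derivationModule_iff hA hα₀] at hη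
      obtain ⟨h1, h2⟩ := hη
      rw [← hspan] at h1
      obtain ⟨g, rfl⟩ := (Submodule.mem_span_range_iff_exists_fun _).1 h1
      -- Tangency to `H₀` makes `∑ g i * f i` a multiple `α₀ * v`; this `v` is the new coefficient
      -- of `α₀ • θ l`.
      have h3 : symRestrict H₀ (∑ i, g i * f i) = 0 := by
        rw [← symRestrict_eq_zero_iff hα₀, derivation_finset_sum_apply, map_sum] at h2
        rw [← mul_eq_zero_iff_right hl, map_sum, Finset.sum_mul, ← h2]
        refine Finset.sum_congr rfl fun i _ => ?_
        rw [map_mul, map_mul, hf i, mul_assoc]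
      rw [symRestrict_eq_zero_iff hα₀] at h3
      obtain ⟨v, hv⟩ := h3
      refine (Submodule.mem_span_range_iff_exists_fun _).2 ⟨Function.update g l v, ?_⟩
      rw [hcomb]
      refine Finset.sum_congr rfl fun i _ => ?_
      congr 1
      by_cases hi : i = l
      · subst hi
        have h4 : ∑ j, Function.update g i v j * f j = ∑ j, g j * f j + v - g i := by
          rw [← Finset.add_sum_erase _ _ (Finset.mem_univ i),
            ← Finset.add_sum_erase _ (fun j => g j * f j) (Finset.mem_univ i),
            Function.update_self, hfl,
            Finset.sum_congr rfl fun j hj => by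
              rw [Function.update_of_ne (Finset.ne_of_mem_erase hj)]]
          ring
        rw [if_pos rfl, Function.update_self, h4, hv]
        ring
      · rw [if_neg hi, Function.update_of_ne hi, add_zero]
  · intro i α
    by_cases hi : i = l
    · subst hi
      simp only [θ', if_true, Function.update_self, Derivation.smul_apply, smul_eq_mul]
      rw [pow_succ']
      exact Submodule.mul_mem_mul ⟨α₀, rfl⟩ (hd i α)
    · simp only [θ', if_neg hi, Function.update_of_ne hi, Derivation.sub_apply]
      exact sub_mem (hd i α) (hfd i α)

/-- **Addition.** If `A''` is free with exponents `E`, and `A'` is free with exponents `E` and `m`,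
then `A` is free with exponents `E` and `m + 1`; here `m` is the degree of a polynomial `q` on `H₀`
that divides the restriction of `θ(α₀)` for every `θ ∈ D(A')`. -/
theorem isFreeWithExponents_addition {A : HyperplaneArrangement K V} {H₀ : Submodule K V}
    (hA : H₀ ∈ A.hyperplanes) {α₀ : Module.Dual K V} (hα₀ : LinearMap.ker α₀ = H₀)
    {E : Multiset ℕ} {m : ℕ} (hE : (A.restriction H₀).IsFreeWithExponents E)
    (hE' : (A.deletion H₀).IsFreeWithExponents (m ::ₘ E))
    {q : SymmetricAlgebra K (Module.Dual K H₀)}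
    (hqm : q ∈ LinearMap.range (ι K (Module.Dual K H₀)) ^ m)
    (hdvd : ∀ θ ∈ (A.deletion H₀).derivationModule, q ∣ symRestrict H₀ (θ (ι K _ α₀))) :
    A.IsFreeWithExponents ((m + 1) ::ₘ E) := by
  classical
  obtain ⟨n, θ, d, hli, hspan, hd, hdE⟩ := hE'.exists_linearIndependent
  have hθmem : ∀ i, θ i ∈ (A.deletion H₀).derivationModule := fun i => by
    rw [← hspan]; exact Submodule.subset_span ⟨i, rfl⟩
  choose g hg hgd hg0 using fun i => exists_eq_component_mul hqm
      (mapHom_mem H₀.dualRestrict (hd i α₀)) (hdvd _ (hθmem i))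
  by_cases hl : ∃ l, d l = m ∧ symRestrict H₀ (θ l (ι K _ α₀)) ≠ 0
  · obtain ⟨l, hlm, hl⟩ := hl
    -- The quotient by `q` has degree zero, so the restriction of `θ l (α₀)` is a non-zero scalar
    -- times `q`, and it divides whatever `q` divides.
    have hgl := hgd l hlm.ge
    rw [hlm, Nat.sub_self, pow_zero, Submodule.mem_one] at hgl
    obtain ⟨c, hc⟩ := hgl
    have hc0 : c ≠ 0 := by
      rintro rfl
      refine hl ?_
      rw [symRestrict, hg l, ← hc, map_zero, zero_mul]
    have h := isFreeWithExponents_of_exists hA hα₀ hli hspan hd l hl fun i => by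
      refine dvd_trans ?_ (hdvd _ (hθmem i))
      refine ⟨algebraMap K _ c⁻¹, ?_⟩
      rw [symRestrict, hg l, ← hc, mul_right_comm, ← map_mul, mul_inv_cancel₀ hc0, map_one, one_mul]
    have hE2 : Finset.univ.val.map (Function.update d l (d l + 1)) = (m + 1) ::ₘ E := by
      have hu : (Finset.univ : Finset (Fin n)).val = l ::ₘ Finset.univ.val.erase l :=
        (Multiset.cons_erase (Finset.mem_univ_val l)).symm
      rw [hu, Multiset.map_cons, hlm] at hdE
      rw [hu, Multiset.map_cons, Function.update_self, hlm, (Multiset.cons_inj_right m).1 hdE]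
      congr 1
      refine Multiset.map_congr rfl fun i hi => Function.update_of_ne ?_ _ _
      exact ((Multiset.Nodup.mem_erase_iff Finset.univ.nodup).1 hi).1
    rwa [hE2] at h
  · push Not at hl
    exfalso
    -- Without a pivot, every basis element of degree at most `m` is tangent to `H₀`: below degree
    -- `m` the quotient by `q` is zero. But `m ::ₘ E` has one more entry `≤ m` than `E`.
    have h1 := card_filter_degree_le hA hE hli hspan hd (k := m) fun i hi => by
      rw [mem_derivationModule_iff hA hα₀]
      refine ⟨hθmem i, ?_⟩
      rw [← symRestrict_eq_zero_iff hα₀]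
      rcases hi.lt_or_eq with hlt | heq
      · rw [symRestrict, hg i, hg0 i hlt, zero_mul]
      · exact hl i heq
    rw [← Finset.countP_univ_map d (· ≤ m), ← hdE,
      Multiset.countP_cons_of_pos (p := (· ≤ m)) _ le_rfl] at h1
    omega

/-! ### Divisibility by the polynomial of a block -/

theorem isRelPrime_ι {α β : Module.Dual K V} (hα : α ≠ 0) (hβ : β ≠ 0)
    (h : LinearMap.ker α ≠ LinearMap.ker β) : IsRelPrime (ι K _ α) (ι K _ β) := by
  refine (prime_ι hα).irreducible.isRelPrime_iff_not_dvd.2 fun hd => h ?_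
  obtain ⟨c, rfl⟩ := exists_smul_of_ι_dvd hd
  rw [LinearMap.ker_smul]
  rintro rfl
  exact hβ (zero_smul _ _)

theorem interIn_eq_ker {X H : Submodule K V} {α : Module.Dual K V} (h : LinearMap.ker α = H) :
    interIn X H = LinearMap.ker (X.dualRestrict α) := by
  rw [← h]; rfl

theorem not_le_of_isCoatom {H₀ H : Submodule K V} (h₀ : IsCoatom H₀) (h : IsCoatom H)
    (hne : H ≠ H₀) : ¬ H₀ ≤ H := fun hle =>
  (h₀.le_iff.1 hle).elim h.1 hne

/-- The expression `θ(α_X) α₀ - α_X θ(α₀)` only changes by a unit when `α_X` is replaced by `α_H = c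
α_X + t α₀`. Hence it is divisible by `α_X` and by every `α_H`. On `H₀` only `-α_X θ(α₀)` survives,
and the extra factor `α_X` cancels. -/
theorem prod_symRestrict_dvd_of_fiber {A : HyperplaneArrangement K V} {H₀ : Submodule K V}
    (hA : H₀ ∈ A.hyperplanes) {α : Submodule K V → Module.Dual K V}
    (hα : ∀ H ∈ A.hyperplanes, LinearMap.ker (α H) = H) {θ : Der}
    (hθ : θ ∈ (A.deletion H₀).derivationModule) {X : Submodule K V}
    (hX : X ∈ (A.deletion H₀).hyperplanes) {F : Finset (Submodule K V)}
    (hF : ∀ H ∈ F, H ∈ (A.deletion H₀).hyperplanes) (hXF : X ∉ F)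
    (hint : ∀ H ∈ F, interIn H₀ H = interIn H₀ X) :
    ∏ H ∈ F, symRestrict H₀ (ι K _ (α H)) ∣ symRestrict H₀ (θ (ι K _ (α H₀))) := by
  classical
  have hne : ∀ H ∈ A.hyperplanes, α H ≠ 0 := fun H hH =>
    ne_zero_of_isCoatom_ker ((hα H hH).symm ▸ A.isCoatom H hH)
  have hco : IsCoatom (interIn H₀ X) :=
    isCoatom_interIn (A.isCoatom _ hX.1) (not_le_of_isCoatom (A.isCoatom _ hA) (A.isCoatom _ hX.1)
      hX.2)
  have hres : H₀.dualRestrict (α X) ≠ 0 :=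
    ne_zero_of_isCoatom_ker (interIn_eq_ker (hα X hX.1) ▸ hco)
  have hρ₀ : symRestrict H₀ (ι K _ (α H₀)) = 0 :=
    (symRestrict_eq_zero_iff (hα _ hA) _).2 dvd_rfl
  have key : ∏ H ∈ insert X F, ι K _ (α H) ∣
      θ (ι K _ (α X)) * ι K _ (α H₀) - ι K _ (α X) * θ (ι K _ (α H₀)) := by
    refine Finset.prod_dvd_of_isRelPrime ?_ ?_
    · have hmem : ∀ H ∈ insert X F, H ∈ A.hyperplanes := fun H hH =>
        (Finset.mem_insert.1 hH).elim (fun h => h ▸ hX.1) fun h => (hF H h).1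
      intro H hH H' hH' hHH'
      refine isRelPrime_ι (hne _ (hmem H hH)) (hne _ (hmem H' hH')) ?_
      rwa [hα _ (hmem H hH), hα _ (hmem H' hH')]
    · intro H hH
      rcases Finset.mem_insert.1 hH with rfl | hH
      · exact dvd_sub ((hθ _ hX _ (hα _ hX.1)).mul_right _) (dvd_mul_right _ _)
      · have hker := hint H hH
        rw [interIn_eq_ker (hα _ (hF H hH).1), interIn_eq_ker (hα _ hX.1)] at hker
        obtain ⟨c, hc, hcH⟩ := exists_eq_smul_of_ker_eq hres hker.symm
        have hmem : α H - c • α X ∈ LinearMap.ker H₀.dualRestrict := by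
          rw [LinearMap.mem_ker, map_sub, map_smul, hcH, sub_self]
        have hk := ker_dualRestrict_ker (α H₀)
        rw [hα _ hA] at hk
        rw [hk, Submodule.mem_span_singleton] at hmem
        obtain ⟨t, ht⟩ := hmem
        have hιH : ι K _ (α H) = algebraMap K _ c * ι K _ (α X) +
            algebraMap K _ t * ι K _ (α H₀) := by
          rw [← Algebra.smul_def, ← Algebra.smul_def, ← map_smul, ← map_smul, ← map_add, ht,
            add_sub_cancel]
        have hθH : θ (ι K _ (α H)) = algebraMap K _ c * θ (ι K _ (α X)) +
            algebraMap K _ t * θ (ι K _ (α H₀)) := by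
          rw [hιH, ← Algebra.smul_def, ← Algebra.smul_def, ← Algebra.smul_def, ← Algebra.smul_def,
            Derivation.map_add, Derivation.map_smul, Derivation.map_smul]
        have hu : IsUnit (algebraMap K Sym c) := (IsUnit.mk0 c hc).map _
        rw [← hu.dvd_mul_left]
        have heq : algebraMap K Sym c * (θ (ι K _ (α X)) * ι K _ (α H₀) -
            ι K _ (α X) * θ (ι K _ (α H₀))) =
            θ (ι K _ (α H)) * ι K _ (α H₀) - ι K _ (α H) * θ (ι K _ (α H₀)) := by
          rw [hθH, hιH]
          ring
        rw [heq]
        exact dvd_sub ((hθ _ (hF H hH) _ (hα _ (hF H hH).1)).mul_right _) (dvd_mul_right _ _)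
  have h1 := map_dvd (symRestrict H₀) key
  rw [map_prod, Finset.prod_insert hXF, map_sub, map_mul, map_mul, hρ₀, mul_zero, zero_sub,
    dvd_neg] at h1
  refine (mul_dvd_mul_iff_left ?_).1 h1
  rw [symRestrict, mapHom_ι]
  exact ι_ne_zero hres

/-- Group `F` by intersection with `H₀`. Surjectivity supplies for each group a hyperplane `X`
outside `B` with the same trace, so no factor of `F` is lost to the cancellation; different groups
give coprime products. -/
theorem prod_symRestrict_dvd {A : HyperplaneArrangement K V} {H₀ : Submodule K V}
    (hA : H₀ ∈ A.hyperplanes) {α : Submodule K V → Module.Dual K V}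
    (hα : ∀ H ∈ A.hyperplanes, LinearMap.ker (α H) = H) {θ : Der}
    (hθ : θ ∈ (A.deletion H₀).derivationModule) {B : Set (Submodule K V)} (hB : H₀ ∈ B)
    (hsurj : Set.SurjOn (interIn H₀) (A.hyperplanes \ B) (A.restriction H₀).hyperplanes)
    {F : Finset (Submodule K V)} (hF : ∀ H ∈ F, H ∈ (A.deletion H₀).hyperplanes)
    (hFB : ∀ H ∈ F, H ∈ B) :
    ∏ H ∈ F, symRestrict H₀ (ι K _ (α H)) ∣ symRestrict H₀ (θ (ι K _ (α H₀))) := by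
  classical
  have hmem : ∀ H ∈ F, interIn H₀ H ∈ (A.restriction H₀).hyperplanes := fun H hH =>
    restriction_hyperplanes A hA ▸ ⟨H, hF H hH, rfl⟩
  rw [← Finset.prod_fiberwise_of_maps_to (fun H hH => Finset.mem_image_of_mem (interIn H₀) hH)]
  refine Finset.prod_dvd_of_isRelPrime ?_ ?_
  · intro Y hY Z hZ hYZ
    refine IsRelPrime.prod_left fun H hH => IsRelPrime.prod_right fun H' hH' => ?_
    rw [Finset.mem_filter] at hH hH'
    have hne : ∀ H ∈ F, H₀.dualRestrict (α H) ≠ 0 := fun H hH =>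
      ne_zero_of_isCoatom_ker
        (interIn_eq_ker (hα H (hF H hH).1) ▸ (A.restriction H₀).isCoatom _ (hmem H hH))
    rw [symRestrict, mapHom_ι, mapHom_ι]
    refine isRelPrime_ι (hne _ hH.1) (hne _ hH'.1) ?_
    rwa [← interIn_eq_ker (hα _ (hF _ hH.1).1), ← interIn_eq_ker (hα _ (hF _ hH'.1).1), hH.2, hH'.2]
  · intro Y hY
    obtain ⟨H, hH, rfl⟩ := Finset.mem_image.1 hY
    obtain ⟨X, hX, hXH⟩ := hsurj (hmem H hH)
    refine prod_symRestrict_dvd_of_fiber hA hα hθ (X := X) ⟨hX.1, ?_⟩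
      (fun H' hH' => hF _ (Finset.mem_filter.1 hH').1)
      (fun hXF => hX.2 (hFB _ (Finset.mem_filter.1 hXF).1))
      (fun H' hH' => (Finset.mem_filter.1 hH').2.trans hXH.symm)
    rintro rfl
    exact hX.2 hB

theorem prod_ι_mem {M : Type w} [AddCommGroup M] [Module K M] {ι' : Type*} (F : Finset ι')
    (a : ι' → M) : ∏ i ∈ F, ι K M (a i) ∈ LinearMap.range (ι K M) ^ F.card := by
  classical
  induction F using Finset.induction with
  | empty => rw [Finset.prod_empty, Finset.card_empty, pow_zero]; exact Submodule.one_le.1 le_rfl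
  | insert i F hi ih =>
    rw [Finset.prod_insert hi, Finset.card_insert_of_notMem hi, pow_succ']
    exact Submodule.mul_mem_mul ⟨a i, rfl⟩ ih

/-! ### Exponents from block sizes -/

theorem ncard_insert_filter {X : Type*} {T : Set (Set X)} (hT : T.Finite) {B : Set X}
    (hB : B ∉ T) (k : ℕ) :
    {C ∈ insert B T | C.ncard = k}.ncard =
      {C ∈ T | C.ncard = k}.ncard + if B.ncard = k then 1 else 0 := by
  split_ifs with h
  · have : {C ∈ insert B T | C.ncard = k} = insert B {C ∈ T | C.ncard = k} := by
      ext C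
      simp only [Set.mem_insert_iff, Set.mem_ofPred_eq]
      constructor
      · rintro ⟨rfl | h1, h2⟩
        · exact Or.inl rfl
        · exact Or.inr ⟨h1, h2⟩
      · rintro (rfl | ⟨h1, h2⟩)
        · exact ⟨Or.inl rfl, h⟩
        · exact ⟨Or.inr h1, h2⟩
    rw [this, Set.ncard_insert_of_notMem (fun hmem => hB hmem.1) (hT.subset fun _ h => h.1)]
  · congr 1
    ext C
    simp only [Set.mem_insert_iff, Set.mem_ofPred_eq]
    constructor
    · rintro ⟨rfl | h1, h2⟩
      · exact absurd h2 h
      · exact ⟨h1, h2⟩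
    · exact fun h => ⟨Or.inr h.1, h.2⟩

/-- Blocks are non-empty and only see the non-zero exponents; the multiplicity of zero is recovered
from the dimension. -/
theorem _root_.Multiset.eq_of_count_pos {E F : Multiset ℕ}
    (hcard : Multiset.card E = Multiset.card F)
    (h : ∀ k, 0 < k → E.count k = F.count k) : E = F := by
  have hfil : E.filter (· ≠ 0) = F.filter (· ≠ 0) := by
    ext k
    rcases Nat.eq_zero_or_pos k with rfl | hk
    · simp
    · rw [Multiset.count_filter_of_pos (p := (· ≠ 0)) hk.ne',
        Multiset.count_filter_of_pos (p := (· ≠ 0)) hk.ne', h k hk]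
  have hsplit : ∀ G : Multiset ℕ, Multiset.card G = (G.filter (· ≠ 0)).card + G.count 0 := by
    intro G
    induction G using Multiset.induction with
    | empty => simp
    | cons a G ih =>
      by_cases ha : a = 0
      · subst ha
        simp [ih, add_assoc]
      · simp [ih, ha, Ne.symm ha]; omega
  ext k
  rcases Nat.eq_zero_or_pos k with rfl | hk
  · rw [hsplit E, hsplit F, hfil] at hcard
    omega
  · exact h k hk

theorem IsPartition.subset {A : HyperplaneArrangement K V} {π : Set (Set (Submodule K V))}
    (hπ : A.IsPartition π) {B : Set (Submodule K V)} (hB : B ∈ π) : B ⊆ A.hyperplanes :=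
  hπ.sUnion ▸ Set.subset_sUnion_of_mem hB

theorem IsPartition.finite {A : HyperplaneArrangement K V} {π : Set (Set (Submodule K V))}
    (hπ : A.IsPartition π) : π.Finite :=
  A.finite.finite_subsets.subset fun _ hB => hπ.subset hB

theorem IsPartition.notMem_of_ne {A : HyperplaneArrangement K V} {π : Set (Set (Submodule K V))}
    (hπ : A.IsPartition π) {B C : Set (Submodule K V)} (hB : B ∈ π) (hC : C ∈ π) (hne : B ≠ C)
    {H : Submodule K V} (hH : H ∈ B) : H ∉ C := fun hH' =>
  Set.disjoint_left.1 (hπ.disjoint hB hC hne) hH hH'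

theorem IsPartition.subset_diff {A : HyperplaneArrangement K V} {π : Set (Set (Submodule K V))}
    (hπ : A.IsPartition π) {B C : Set (Submodule K V)} (hB : B ∈ π) (hC : C ∈ π) (hne : B ≠ C) :
    B ⊆ A.hyperplanes \ C := fun _ hH => ⟨hπ.subset hB hH, hπ.notMem_of_ne hB hC hne hH⟩

/-- Only the block of `H₀` changes; the condition `C.Nonempty` removes it when `B₁ = {H₀}`. -/
theorem deletionPartition_eq {A : HyperplaneArrangement K V} {π : Set (Set (Submodule K V))}
    (hπ : A.IsPartition π) {B₁ : Set (Submodule K V)} (hB₁ : B₁ ∈ π) {H₀ : Submodule K V}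
    (hH₀ : H₀ ∈ B₁) :
    A.deletionPartition π H₀ = {C | C.Nonempty ∧ C ∈ insert (B₁ \ {H₀}) (π \ {B₁})} := by
  have h1 : B₁ ∩ (A.deletion H₀).hyperplanes = B₁ \ {H₀} := by
    ext H
    exact ⟨fun h => ⟨h.1, h.2.2⟩, fun h => ⟨h.1, hπ.subset hB₁ h.1, h.2⟩⟩
  have h2 : ∀ B ∈ π, B ≠ B₁ → B ∩ (A.deletion H₀).hyperplanes = B := by
    intro B hB hne
    refine Set.inter_eq_left.2 fun H hH => ⟨hπ.subset hB hH, ?_⟩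
    rintro rfl
    exact hπ.notMem_of_ne hB hB₁ hne hH hH₀
  ext C
  refine and_congr_right fun _ => ⟨?_, ?_⟩
  · rintro ⟨B, hB, rfl⟩
    by_cases hBB : B = B₁
    · subst hBB
      exact Or.inl h1
    · rw [h2 B hB hBB]
      exact Or.inr ⟨hB, hBB⟩
  · rintro (rfl | ⟨hC, hne⟩)
    · exact ⟨B₁, hB₁, h1.symm⟩
    · exact ⟨C, hC, (h2 C hC hne).symm⟩

/-- An inductively factored arrangement is free. Its non-zero exponents are the cardinalities of
the blocks of an inductive factorization. -/
theorem IsInductiveFactorization.exists_exponents {A : HyperplaneArrangement K V}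
    {π : Set (Set (Submodule K V))} (h : IsInductiveFactorization A π) :
    ∀ [FiniteDimensional K V], ∃ E : Multiset ℕ, A.IsFreeWithExponents E ∧
      Multiset.card E = Module.finrank K V ∧
      ∀ k, 0 < k → E.count k = {B ∈ π | B.ncard = k}.ncard := by
  induction h with
  | empty V =>
    intro _
    refine ⟨_, isFreeWithExponents_empty, Multiset.card_replicate _ _, fun k hk => ?_⟩
    simp [Multiset.count_replicate, hk.ne]
  | @addition V _ _ A π hπ B₁ hB₁ H₀ hH₀ bij _ _ ih' ih'' =>
    intro _
    have hA : H₀ ∈ A.hyperplanes := hπ.subset hB₁ hH₀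
    obtain ⟨E', hE', hcard', hcount'⟩ := ih'
    obtain ⟨E'', hE'', hcard'', hcount''⟩ := ih''
    have hex : ∀ H : Submodule K V, ∃ α : Module.Dual K V,
        H ∈ A.hyperplanes → LinearMap.ker α = H := fun H => by
      by_cases hH : H ∈ A.hyperplanes
      · exact (exists_ker_eq (A.isCoatom H hH)).imp fun α hα _ => hα
      · exact ⟨0, fun h => absurd h hH⟩
    choose α hα using hex
    have hα₀ : α H₀ ≠ 0 := ne_zero_of_isCoatom_ker ((hα H₀ hA).symm ▸ A.isCoatom H₀ hA)
    have hrank : Module.finrank K H₀ + 1 = Module.finrank K V := by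
      have := Module.Dual.finrank_ker_add_one_of_ne_zero hα₀
      rwa [hα H₀ hA] at this
    have hB₁fin : B₁.Finite := A.finite.subset (hπ.subset hB₁)
    have hfin : (B₁ \ {H₀}).Finite := hB₁fin.subset Set.sdiff_subset
    have hTfin : (π \ {B₁}).Finite := hπ.finite.subset Set.sdiff_subset
    have hsub : ∀ B ∈ π \ {B₁}, B ⊆ A.hyperplanes \ B₁ := fun B hB =>
      hπ.subset_diff hB.1 hB₁ hB.2
    -- Injectivity of `H ↦ H₀ ∩ H` off `B₁` keeps the other blocks distinct and of the same size.
    have hN'' : ∀ k, 0 < k → E''.count k = {B ∈ π \ {B₁} | B.ncard = k}.ncard := by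
      intro k hk
      rw [hcount'' k hk]
      have himage : {C ∈ restrictionPartition π B₁ H₀ | C.ncard = k} =
          (fun B => interIn H₀ '' B) '' {B ∈ π \ {B₁} | B.ncard = k} := by
        ext C
        constructor
        · rintro ⟨⟨B, hB, rfl⟩, hC⟩
          rw [(bij.injOn.mono (hsub B hB)).ncard_image] at hC
          exact ⟨B, ⟨hB, hC⟩, rfl⟩
        · rintro ⟨B, ⟨hB, hC⟩, rfl⟩
          refine ⟨⟨B, hB, rfl⟩, ?_⟩
          rwa [(bij.injOn.mono (hsub B hB)).ncard_image]
      rw [himage]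
      refine Set.InjOn.ncard_image fun B hB C hC hBC => ?_
      exact (bij.injOn.image_eq_image_iff (hsub B hB.1) (hsub C hC.1)).1 hBC
    -- This is the relation required by the addition theorem. A possibly empty `B₁ \ {H₀}`
    -- contributes an exponent zero, which is not counted for `k > 0`.
    have hEm : E' = (B₁ \ {H₀}).ncard ::ₘ E'' := by
      refine Multiset.eq_of_count_pos ?_ fun k hk => ?_
      · rw [Multiset.card_cons, hcard', hcard'', hrank]
      · rw [hcount' k hk, Multiset.count_cons, hN'' k hk, deletionPartition_eq hπ hB₁ hH₀]
        have hset : {B ∈ {C | C.Nonempty ∧ C ∈ insert (B₁ \ {H₀}) (π \ {B₁})} | B.ncard = k} =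
            {B ∈ insert (B₁ \ {H₀}) (π \ {B₁}) | B.ncard = k} := by
          ext C
          refine ⟨fun h => ⟨h.1.2, h.2⟩, fun h => ⟨⟨?_, h.1⟩, h.2⟩⟩
          exact Set.nonempty_of_ncard_ne_zero (h.2 ▸ hk.ne')
        rw [hset, ncard_insert_filter hTfin]
        · simp only [eq_comm]
        · intro hmem
          obtain ⟨H, hH⟩ := hπ.nonempty _ hmem.1
          exact (hsub _ hmem hH).2 hH.1
    have hadd := isFreeWithExponents_addition
      (q := ∏ H ∈ hfin.toFinset, symRestrict H₀ (ι K _ (α H)))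
      hA (hα H₀ hA) hE'' (hEm ▸ hE')
      (by
        rw [Set.ncard_eq_toFinset_card _ hfin]
        simp only [symRestrict, mapHom_ι]
        exact prod_ι_mem _ _)
      (fun θ hθ => prod_symRestrict_dvd hA (fun H hH => hα H hH) hθ hH₀ bij.surjOn
        (fun H hH => by
          rw [Set.Finite.mem_toFinset] at hH
          exact ⟨hπ.subset hB₁ hH.1, hH.2⟩)
        (fun H hH => by
          rw [Set.Finite.mem_toFinset] at hH
          exact hH.1))
    refine ⟨_, hadd, ?_, fun k hk => ?_⟩
    · rw [Multiset.card_cons, hcard'', hrank]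
    · rw [Multiset.count_cons, hN'' k hk]
      have hins : insert B₁ (π \ {B₁}) = π := Set.insert_sdiff_self_of_mem hB₁
      conv_rhs => rw [← hins]
      rw [ncard_insert_filter hTfin (fun h => h.2 rfl), Set.ncard_sdiff_singleton_add_one hH₀ hB₁fin]
      simp only [eq_comm]

end Derivations

/-! ### Joint pullbacks: from the product to its factors -/

section Comap

variable {K : Type*} [Field K] {U : Type*} [AddCommGroup U] [Module K U]
  {V : Type*} [AddCommGroup V] [Module K V] {W : Type*} [AddCommGroup W] [Module K W]
  {f : U →ₗ[K] V} {g : U →ₗ[K] W}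

theorem surjective_left (h : Function.Surjective (f.prod g)) : Function.Surjective f := fun v =>
  (h (v, 0)).imp fun _ hu => congrArg Prod.fst hu

theorem surjective_right (h : Function.Surjective (f.prod g)) : Function.Surjective g := fun w =>
  (h (0, w)).imp fun _ hu => congrArg Prod.snd hu

theorem surjective_prod_swap (h : Function.Surjective (f.prod g)) :
    Function.Surjective (g.prod f) := fun p => by
  obtain ⟨u, hu⟩ := h p.swap
  exact ⟨u, congrArg Prod.swap hu⟩

/-- A vector over `(v, 0)` with `v ∉ H` lies in every preimage under `g` but not in that of `H`. -/
theorem comap_ne_comap (h : Function.Surjective (f.prod g)) {H : Submodule K V} (hH : H ≠ ⊤)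
    (G : Submodule K W) : H.comap f ≠ G.comap g := by
  intro heq
  obtain ⟨v, hv⟩ : ∃ v, v ∉ H := by
    by_contra! hcon
    exact hH (eq_top_iff.2 fun x _ => hcon x)
  obtain ⟨u, hu⟩ := h (v, 0)
  have hu1 : f u = v := congrArg Prod.fst hu
  have hu2 : g u = 0 := congrArg Prod.snd hu
  have hmem : u ∈ G.comap g := by
    rw [Submodule.mem_comap, hu2]; exact zero_mem _
  rw [← heq, Submodule.mem_comap, hu1] at hmem
  exact hv hmem

variable (f) in
/-- The map from the preimage of `H` to `H` induced by `f`. -/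
def comapRestrict (H : Submodule K V) : H.comap f →ₗ[K] H := f.restrict fun _ h => h

variable (f g) in
-- This carries the hypothesis on `(f, g)` over to the restriction, with `H` in place of `V` and `W`
-- unchanged.
theorem surjective_comapRestrict (h : Function.Surjective (f.prod g)) (H : Submodule K V) :
    Function.Surjective ((comapRestrict f H).prod (g ∘ₗ (H.comap f).subtype)) := by
  rintro ⟨v, w⟩
  obtain ⟨u, hu⟩ := h (v.1, w)
  have hu1 : f u = v.1 := congrArg Prod.fst hu
  have hu2 : g u = w := congrArg Prod.snd hu
  refine ⟨⟨u, ?_⟩, Prod.ext (Subtype.ext hu1) hu2⟩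
  rw [Submodule.mem_comap, hu1]
  exact v.2

theorem interIn_comap_left (H₁ H : Submodule K V) :
    interIn (H₁.comap f) (H.comap f) = (interIn H₁ H).comap (comapRestrict f H₁) := rfl

theorem interIn_mem_restriction {A : HyperplaneArrangement K V} {H₀ H : Submodule K V}
    (h₀ : H₀ ∈ A.hyperplanes) (hH : H ∈ A.hyperplanes) (hne : H ≠ H₀) :
    interIn H₀ H ∈ (A.restriction H₀).hyperplanes :=
  ⟨H, ⟨hH, not_le_of_isCoatom (A.isCoatom _ h₀) (A.isCoatom _ hH) hne⟩, rfl⟩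

theorem exists_of_mem_restriction {A : HyperplaneArrangement K V} {H₀ : Submodule K V}
    {X : Submodule K H₀} (hX : X ∈ (A.restriction H₀).hyperplanes) :
    ∃ H ∈ A.hyperplanes, H ≠ H₀ ∧ interIn H₀ H = X := by
  obtain ⟨H, ⟨hH, hle⟩, rfl⟩ := hX
  exact ⟨H, hH, fun h => hle h.ge, rfl⟩

/-- `A` consists of the preimages under `f` and `g` of the hyperplanes of `A₁` and `A₂`. -/
def IsJointPullback (f : U →ₗ[K] V) (g : U →ₗ[K] W) (A : HyperplaneArrangement K U)
    (A₁ : HyperplaneArrangement K V) (A₂ : HyperplaneArrangement K W) : Prop :=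
  A.hyperplanes = Submodule.comap f '' A₁.hyperplanes ∪ Submodule.comap g '' A₂.hyperplanes

variable {A : HyperplaneArrangement K U} {A₁ : HyperplaneArrangement K V}
  {A₂ : HyperplaneArrangement K W}

theorem IsJointPullback.symm (hA : IsJointPullback f g A A₁ A₂) : IsJointPullback g f A A₂ A₁ :=
  hA.trans (Set.union_comm _ _)

theorem IsJointPullback.left_mem (hA : IsJointPullback f g A A₁ A₂) {H : Submodule K V}
    (hH : H ∈ A₁.hyperplanes) : H.comap f ∈ A.hyperplanes :=
  hA.symm ▸ Or.inr ⟨H, hH, rfl⟩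

theorem IsJointPullback.right_mem (hA : IsJointPullback f g A A₁ A₂) {G : Submodule K W}
    (hG : G ∈ A₂.hyperplanes) : G.comap g ∈ A.hyperplanes :=
  hA.symm.left_mem hG

theorem IsJointPullback.deletion (h : Function.Surjective (f.prod g))
    (hA : IsJointPullback f g A A₁ A₂) {H₁ : Submodule K V} (hH₁ : H₁ ∈ A₁.hyperplanes) :
    IsJointPullback f g (A.deletion (H₁.comap f)) (A₁.deletion H₁) A₂ := by
  have hinj := Submodule.comap_injective_of_surjective (surjective_left h)
  ext H
  constructor
  · rintro ⟨hH, hne⟩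
    rw [hA] at hH
    rcases hH with ⟨H', hH', rfl⟩ | hH
    · exact Or.inl ⟨H', ⟨hH', fun heq => hne (congrArg _ heq)⟩, rfl⟩
    · exact Or.inr hH
  · rintro (⟨H', ⟨hH', hne⟩, rfl⟩ | ⟨G, hG, rfl⟩)
    · exact ⟨hA.left_mem hH', fun heq => hne (hinj heq)⟩
    · exact ⟨hA.right_mem hG, fun heq =>
        comap_ne_comap h (A₁.isCoatom _ hH₁).1 G (Set.mem_singleton_iff.1 heq).symm⟩

theorem IsJointPullback.restriction (h : Function.Surjective (f.prod g))
    (hA : IsJointPullback f g A A₁ A₂) {H₁ : Submodule K V} (hH₁ : H₁ ∈ A₁.hyperplanes) :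
    IsJointPullback (comapRestrict f H₁) (g ∘ₗ (H₁.comap f).subtype)
      (A.restriction (H₁.comap f)) (A₁.restriction H₁) A₂ := by
  have hinj := Submodule.comap_injective_of_surjective (surjective_left h)
  ext X
  constructor
  · intro hX
    obtain ⟨H, hH, hne, rfl⟩ := exists_of_mem_restriction hX
    rw [hA] at hH
    rcases hH with ⟨H', hH', rfl⟩ | ⟨G, hG, rfl⟩
    · exact Or.inl ⟨_, interIn_mem_restriction hH₁ hH' fun heq => hne (congrArg _ heq), rfl⟩
    · exact Or.inr ⟨G, hG, rfl⟩
  · rintro (⟨X, hX, rfl⟩ | ⟨G, hG, rfl⟩)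
    · obtain ⟨H, hH, hne, rfl⟩ := exists_of_mem_restriction hX
      exact interIn_mem_restriction (hA.left_mem hH₁) (hA.left_mem hH) fun heq => hne (hinj heq)
    · exact interIn_mem_restriction (hA.left_mem hH₁) (hA.right_mem hG) fun heq =>
        comap_ne_comap h (A₁.isCoatom _ hH₁).1 G heq.symm

/-- The family of sets of hyperplanes of `A₁` induced by a family `π`. -/
def inducedPartition (f : U →ₗ[K] V) (A₁ : HyperplaneArrangement K V)
    (π : Set (Set (Submodule K U))) : Set (Set (Submodule K V)) :=
  {C | C.Nonempty ∧ ∃ B ∈ π, C = {H ∈ A₁.hyperplanes | H.comap f ∈ B}}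

theorem IsPartition.induced {π : Set (Set (Submodule K U))} (hπ : A.IsPartition π)
    (hA : IsJointPullback f g A A₁ A₂) : A₁.IsPartition (inducedPartition f A₁ π) where
  nonempty _ hC := hC.1
  disjoint := by
    rintro _ ⟨_, B, hB, rfl⟩ _ ⟨_, C, hC, rfl⟩ hne
    refine Set.disjoint_left.2 fun H hHB hHC => ?_
    refine hπ.notMem_of_ne hB hC ?_ hHB.2 hHC.2
    rintro rfl
    exact hne rfl
  sUnion := by
    ext H
    constructor
    · rintro ⟨_, ⟨_, B, hB, rfl⟩, hH⟩
      exact hH.1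
    · intro hH
      have hmem := hA.left_mem hH
      rw [← hπ.sUnion] at hmem
      obtain ⟨B, hB, hHB⟩ := hmem
      exact ⟨{H ∈ A₁.hyperplanes | H.comap f ∈ B}, ⟨⟨H, hH, hHB⟩, B, hB, rfl⟩, hH, hHB⟩

/-- For surjectivity, a hyperplane of `A` whose trace comes from `A₁''` cannot come from `A₂`, by
`comap_ne_comap` for the restricted maps. -/
theorem bijOn_of_comap (h : Function.Surjective (f.prod g)) (hA : IsJointPullback f g A A₁ A₂)
    {H₁ : Submodule K V} (hH₁ : H₁ ∈ A₁.hyperplanes) {B₁ : Set (Submodule K U)}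
    (hB₁ : H₁.comap f ∈ B₁)
    (bij : Set.BijOn (interIn (H₁.comap f)) (A.hyperplanes \ B₁)
      (A.restriction (H₁.comap f)).hyperplanes) :
    Set.BijOn (interIn H₁) (A₁.hyperplanes \ {H ∈ A₁.hyperplanes | H.comap f ∈ B₁})
      (A₁.restriction H₁).hyperplanes := by
  have hinj := Submodule.comap_injective_of_surjective (surjective_left h)
  have h' := surjective_comapRestrict f g h H₁
  have hinj' := Submodule.comap_injective_of_surjective (surjective_left h')
  refine ⟨fun H hH => interIn_mem_restriction hH₁ hH.1 ?_, fun H hH H' hH' heq => ?_, fun X hX => ?_⟩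
  · rintro rfl
    exact hH.2 ⟨hH.1, hB₁⟩
  · refine hinj (bij.injOn ⟨hA.left_mem hH.1, fun hB => hH.2 ⟨hH.1, hB⟩⟩
      ⟨hA.left_mem hH'.1, fun hB => hH'.2 ⟨hH'.1, hB⟩⟩ ?_)
    rw [interIn_comap_left, heq, interIn_comap_left]
  · have hX' : X.comap (comapRestrict f H₁) ∈ (A.restriction (H₁.comap f)).hyperplanes :=
      (hA.restriction h hH₁).left_mem hX
    obtain ⟨H, ⟨hH, hHB⟩, hHX⟩ := bij.surjOn hX'
    rw [hA] at hH
    rcases hH with ⟨H', hH', rfl⟩ | ⟨G, hG, rfl⟩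
    · exact ⟨H', ⟨hH', fun hB => hHB hB.2⟩, hinj' hHX⟩
    · exact absurd hHX.symm (comap_ne_comap h' ((A₁.restriction H₁).isCoatom _ hX).1 G)

theorem deletionPartition_inducedPartition (h : Function.Surjective (f.prod g))
    (hA : IsJointPullback f g A A₁ A₂) (π : Set (Set (Submodule K U))) {H₁ : Submodule K V}
    (hH₁ : H₁ ∈ A₁.hyperplanes) :
    A₁.deletionPartition (inducedPartition f A₁ π) H₁ =
      inducedPartition f (A₁.deletion H₁) (A.deletionPartition π (H₁.comap f)) := by
  have hinj := Submodule.comap_injective_of_surjective (surjective_left h)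
  have hset : ∀ B : Set (Submodule K U),
      {H ∈ A₁.hyperplanes | H.comap f ∈ B} ∩ (A₁.deletion H₁).hyperplanes =
      {H ∈ (A₁.deletion H₁).hyperplanes |
        H.comap f ∈ B ∩ (A.deletion (H₁.comap f)).hyperplanes} := by
    intro B
    ext H
    exact ⟨fun hH => ⟨hH.2, hH.1.2, (hA.deletion h hH₁).left_mem hH.2⟩,
      fun hH => ⟨⟨hH.1.1, hH.2.1⟩, hH.1⟩⟩
  ext C
  refine and_congr_right fun hC => ⟨?_, ?_⟩
  · rintro ⟨_, ⟨_, B, hB, rfl⟩, rfl⟩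
    rw [hset] at hC ⊢
    obtain ⟨H, hH⟩ := hC
    exact ⟨_, ⟨⟨_, hH.2⟩, B, hB, rfl⟩, rfl⟩
  · rintro ⟨_, ⟨_, B, hB, rfl⟩, rfl⟩
    rw [← hset] at hC ⊢
    exact ⟨_, ⟨hC.mono Set.inter_subset_left, B, hB, rfl⟩, rfl⟩

theorem inducedPartition_deletionPartition_right (h : Function.Surjective (f.prod g))
    (hA : IsJointPullback f g A A₁ A₂) (π : Set (Set (Submodule K U))) (G : Submodule K W) :
    inducedPartition f A₁ (A.deletionPartition π (G.comap g)) = inducedPartition f A₁ π := by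
  have hset : ∀ B : Set (Submodule K U),
      {H ∈ A₁.hyperplanes | H.comap f ∈ B ∩ (A.deletion (G.comap g)).hyperplanes} =
      {H ∈ A₁.hyperplanes | H.comap f ∈ B} := by
    intro B
    ext H
    exact ⟨fun hH => ⟨hH.1, hH.2.1⟩, fun hH => ⟨hH.1, hH.2, hA.left_mem hH.1,
      comap_ne_comap h (A₁.isCoatom _ hH.1).1 G⟩⟩
  ext C
  refine and_congr_right fun hC => ⟨?_, ?_⟩
  · rintro ⟨_, ⟨_, B, hB, rfl⟩, rfl⟩
    exact ⟨B, hB, hset B⟩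
  · rintro ⟨B, hB, rfl⟩
    refine ⟨_, ⟨?_, B, hB, rfl⟩, (hset B).symm⟩
    rw [← hset] at hC
    obtain ⟨H, hH⟩ := hC
    exact ⟨_, hH.2⟩

theorem restrictionPartition_inducedPartition (h : Function.Surjective (f.prod g))
    (hA : IsJointPullback f g A A₁ A₂) {π : Set (Set (Submodule K U))} (hπ : A.IsPartition π)
    {B₁ : Set (Submodule K U)} (hBπ : B₁ ∈ π) {H₁ : Submodule K V} (hH₁ : H₁ ∈ A₁.hyperplanes)
    (hB₁ : H₁.comap f ∈ B₁) :
    restrictionPartition (inducedPartition f A₁ π) {H ∈ A₁.hyperplanes | H.comap f ∈ B₁} H₁ =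
      inducedPartition (comapRestrict f H₁) (A₁.restriction H₁)
        (restrictionPartition π B₁ (H₁.comap f)) := by
  have h' := surjective_comapRestrict f g h H₁
  have hinj' := Submodule.comap_injective_of_surjective (surjective_left h')
  have hset : ∀ B ∈ π, B ≠ B₁ →
      interIn H₁ '' {H ∈ A₁.hyperplanes | H.comap f ∈ B} =
      {X ∈ (A₁.restriction H₁).hyperplanes |
        X.comap (comapRestrict f H₁) ∈ interIn (H₁.comap f) '' B} := by
    intro B hB hne
    ext X
    constructor
    · rintro ⟨H, ⟨hH, hHB⟩, rfl⟩
      refine ⟨interIn_mem_restriction hH₁ hH ?_, _, hHB, rfl⟩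
      rintro rfl
      exact hπ.notMem_of_ne hB hBπ hne hHB hB₁
    · rintro ⟨hX, H, hH, hHX⟩
      have hHA := hπ.subset hB hH
      rw [hA] at hHA
      rcases hHA with ⟨H', hH', rfl⟩ | ⟨G, hG, rfl⟩
      · exact ⟨H', ⟨hH', hH⟩, hinj' hHX⟩
      · exact absurd hHX.symm (comap_ne_comap h' ((A₁.restriction H₁).isCoatom _ hX).1 G)
  ext C
  constructor
  · rintro ⟨_, ⟨⟨hne, B, hB, rfl⟩, hBB⟩, rfl⟩
    have hBne : B ≠ B₁ := by
      rintro rfl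
      exact hBB rfl
    exact ⟨hne.image _, _, ⟨B, ⟨hB, hBne⟩, rfl⟩, hset B hB hBne⟩
  · rintro ⟨hne, _, ⟨B, ⟨hB, hBne⟩, rfl⟩, rfl⟩
    rw [← hset B hB hBne] at hne
    obtain ⟨H, hH⟩ := Set.image_nonempty.1 hne
    -- Distinct blocks could only have equal traces on `A₁` if both were empty.
    refine ⟨_, ⟨⟨⟨H, hH⟩, B, hB, rfl⟩, fun heq => ?_⟩, hset B hB hBne⟩
    rw [Set.mem_singleton_iff] at heq
    rw [heq] at hH
    have hH2 : H ∈ {H ∈ A₁.hyperplanes | H.comap f ∈ B} := heq ▸ hH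
    exact hπ.notMem_of_ne hB hBπ hBne hH2.2 hH.2

end Comap

theorem isInductiveFactorization_empty_of_hyperplanes {K : Type u} [Field K] {V : Type v}
    [AddCommGroup V] [Module K V] {A : HyperplaneArrangement K V}
    {π : Set (Set (Submodule K V))} (hA : A.hyperplanes = ∅) (hπ : π = ∅) :
    IsInductiveFactorization A π := by
  have : A = HyperplaneArrangement.empty K V := HyperplaneArrangement.ext hA
  rw [this, hπ]
  exact .empty V

/-- An inductive factorization of a product induces one of each factor. -/
theorem IsInductiveFactorization.induced {K : Type u} [Field K] {U : Type v} [AddCommGroup U]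
    [Module K U] {A : HyperplaneArrangement K U} {π : Set (Set (Submodule K U))}
    (hAπ : IsInductiveFactorization A π) :
    ∀ {V : Type w} [AddCommGroup V] [Module K V] {W : Type*} [AddCommGroup W] [Module K W]
      {f : U →ₗ[K] V} {g : U →ₗ[K] W} (_ : Function.Surjective (f.prod g))
      {A₁ : HyperplaneArrangement K V} {A₂ : HyperplaneArrangement K W}
      (_ : IsJointPullback f g A A₁ A₂),
      IsInductiveFactorization A₁ (inducedPartition f A₁ π) := by
  induction hAπ with
  | empty U =>
    intro V _ _ W _ _ f g h A₁ A₂ hA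
    refine isInductiveFactorization_empty_of_hyperplanes ?_ ?_
    · exact Set.eq_empty_of_forall_notMem fun H hH => hA.left_mem hH
    · exact Set.eq_empty_of_forall_notMem fun C hC => by
        obtain ⟨_, B, hB, _⟩ := hC
        exact hB
  | @addition U _ _ A π hπ B₁ hB₁ H₀ hH₀ bij _ _ ih' ih'' =>
    intro V _ _ W _ _ f g h A₁ A₂ hA
    have hH₀A := hπ.subset hB₁ hH₀
    rw [hA] at hH₀A
    rcases hH₀A with ⟨H₁, hH₁, rfl⟩ | ⟨G, hG, rfl⟩
    · refine .addition A₁ _ (hπ.induced hA) {H ∈ A₁.hyperplanes | H.comap f ∈ B₁}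
        ⟨⟨H₁, hH₁, hH₀⟩, B₁, hB₁, rfl⟩ H₁ ⟨hH₁, hH₀⟩ (bijOn_of_comap h hA hH₁ hH₀ bij) ?_ ?_
      · rw [deletionPartition_inducedPartition h hA π hH₁]
        exact ih' h (hA.deletion h hH₁)
      · rw [restrictionPartition_inducedPartition h hA hπ hB₁ hH₁ hH₀]
        exact ih'' (surjective_comapRestrict f g h H₁) (hA.restriction h hH₁)
    -- Deleting a hyperplane of `A₂` leaves `A₁` and its induced partition unchanged, so the
    -- deletion hypothesis suffices.
    · rw [← inducedPartition_deletionPartition_right h hA π G]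
      exact ih' h (hA.symm.deletion (surjective_prod_swap h) hG).symm

/-! ### From the factors to the product -/

section Pullback

variable {K : Type*} [Field K] {U : Type*} [AddCommGroup U] [Module K U]
  {V : Type*} [AddCommGroup V] [Module K V] {W : Type*} [AddCommGroup W] [Module K W]
  {f : U →ₗ[K] V} {g : U →ₗ[K] W}
  {A : HyperplaneArrangement K U} {A₁ : HyperplaneArrangement K V}
  {A₂ : HyperplaneArrangement K W}
  {π₁ : Set (Set (Submodule K V))} {π₂ : Set (Set (Submodule K W))}

/-- The family of the preimages under `f` and `g` of the blocks of `π₁` and `π₂`. -/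
def jointPartition (f : U →ₗ[K] V) (g : U →ₗ[K] W) (π₁ : Set (Set (Submodule K V)))
    (π₂ : Set (Set (Submodule K W))) : Set (Set (Submodule K U)) :=
  Set.image (Submodule.comap f) '' π₁ ∪ Set.image (Submodule.comap g) '' π₂

theorem disjoint_image_comap (h : Function.Surjective (f.prod g)) {B : Set (Submodule K V)}
    (hB : B ⊆ A₁.hyperplanes) (C : Set (Submodule K W)) :
    Disjoint (Submodule.comap f '' B) (Submodule.comap g '' C) := by
  refine Set.disjoint_left.2 ?_
  rintro _ ⟨H, hH, rfl⟩ ⟨G, _, hG⟩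
  exact comap_ne_comap h (A₁.isCoatom _ (hB hH)).1 G hG.symm

theorem IsPartition.joint (h : Function.Surjective (f.prod g)) (hA : IsJointPullback f g A A₁ A₂)
    (hπ₁ : A₁.IsPartition π₁) (hπ₂ : A₂.IsPartition π₂) :
    A.IsPartition (jointPartition f g π₁ π₂) where
  nonempty := by
    rintro _ (⟨B, hB, rfl⟩ | ⟨B, hB, rfl⟩)
    · exact (hπ₁.nonempty B hB).image _
    · exact (hπ₂.nonempty B hB).image _
  disjoint := by
    have hf := Submodule.comap_injective_of_surjective (surjective_left h)
    have hg := Submodule.comap_injective_of_surjective (surjective_right h)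
    rintro _ (⟨B, hB, rfl⟩ | ⟨B, hB, rfl⟩) _ (⟨C, hC, rfl⟩ | ⟨C, hC, rfl⟩) hne
    · exact (Set.disjoint_image_iff hf).2 (hπ₁.disjoint hB hC fun heq => hne (heq ▸ rfl))
    · exact disjoint_image_comap h (hπ₁.subset hB) C
    · exact (disjoint_image_comap h (hπ₁.subset hC) B).symm
    · exact (Set.disjoint_image_iff hg).2 (hπ₂.disjoint hB hC fun heq => hne (heq ▸ rfl))
  sUnion := by
    rw [hA, jointPartition, Set.sUnion_union, ← hπ₁.sUnion, ← hπ₂.sUnion, Set.image_sUnion,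
      Set.image_sUnion]

/-- All hyperplanes from `A₂` lie outside the block, and they restrict to the preimages of the same
hyperplanes, so they add a bijective part disjoint from the given one. -/
theorem bijOn_comap (h : Function.Surjective (f.prod g)) (hA : IsJointPullback f g A A₁ A₂)
    {B₁ : Set (Submodule K V)} (hB₁ : B₁ ⊆ A₁.hyperplanes)
    {H₁ : Submodule K V} (hH₁ : H₁ ∈ B₁)
    (bij : Set.BijOn (interIn H₁) (A₁.hyperplanes \ B₁) (A₁.restriction H₁).hyperplanes) :
    Set.BijOn (interIn (H₁.comap f)) (A.hyperplanes \ (Submodule.comap f '' B₁))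
      (A.restriction (H₁.comap f)).hyperplanes := by
  have hf := Submodule.comap_injective_of_surjective (surjective_left h)
  have h' := surjective_comapRestrict f g h H₁
  have hf' := Submodule.comap_injective_of_surjective (surjective_left h')
  have hg' := Submodule.comap_injective_of_surjective (surjective_right h')
  have hdiff : A.hyperplanes \ (Submodule.comap f '' B₁) =
      Submodule.comap f '' (A₁.hyperplanes \ B₁) ∪ Submodule.comap g '' A₂.hyperplanes := by
    rw [hA, Set.union_sdiff_distrib, Set.image_sdiff hf,
      (disjoint_image_comap h hB₁ A₂.hyperplanes).symm.sdiff_eq_left]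
  have hcoatom : ∀ H ∈ A₁.hyperplanes \ B₁, interIn H₁ H ≠ ⊤ := fun H hH =>
    ((A₁.restriction H₁).isCoatom _ (bij.mapsTo hH)).1
  rw [hdiff, hA.restriction h (hB₁ hH₁)]
  refine ⟨?_, ?_, ?_⟩
  · rintro _ (⟨H, hH, rfl⟩ | ⟨G, hG, rfl⟩)
    · exact Or.inl ⟨_, bij.mapsTo hH, rfl⟩
    · exact Or.inr ⟨G, hG, rfl⟩
  · rintro _ (⟨H, hH, rfl⟩ | ⟨G, hG, rfl⟩) _ (⟨H', hH', rfl⟩ | ⟨G', hG', rfl⟩) heq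
    · exact congrArg _ (bij.injOn hH hH' (hf' heq))
    · exact absurd heq (comap_ne_comap h' (hcoatom H hH) G')
    · exact absurd heq.symm (comap_ne_comap h' (hcoatom H' hH') G)
    · exact congrArg _ (hg' heq)
  · rintro _ (⟨X, hX, rfl⟩ | ⟨G, hG, rfl⟩)
    · obtain ⟨H, hH, rfl⟩ := bij.surjOn hX
      exact ⟨_, Or.inl ⟨H, hH, rfl⟩, rfl⟩
    · exact ⟨_, Or.inr ⟨G, hG, rfl⟩, rfl⟩

theorem deletionPartition_jointPartition (h : Function.Surjective (f.prod g))
    (hA : IsJointPullback f g A A₁ A₂) (hπ₂ : A₂.IsPartition π₂) {H₁ : Submodule K V}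
    (hH₁ : H₁ ∈ A₁.hyperplanes) :
    A.deletionPartition (jointPartition f g π₁ π₂) (H₁.comap f) =
      jointPartition f g (A₁.deletionPartition π₁ H₁) π₂ := by
  have hf := Submodule.comap_injective_of_surjective (surjective_left h)
  have hdel : (A.deletion (H₁.comap f)).hyperplanes = _ := hA.deletion h hH₁
  have h1 : ∀ B : Set (Submodule K V),
      Submodule.comap f '' B ∩ (A.deletion (H₁.comap f)).hyperplanes =
        Submodule.comap f '' (B ∩ (A₁.deletion H₁).hyperplanes) := by
    intro B
    ext X
    constructor
    · rintro ⟨⟨H, hH, rfl⟩, hX⟩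
      rw [hdel] at hX
      rcases hX with ⟨H', hH', heq⟩ | ⟨G, hG, heq⟩
      · exact ⟨H, ⟨hH, hf heq ▸ hH'⟩, rfl⟩
      · have hGt : G ≠ ⊤ := (A₂.isCoatom _ hG).1
        exact absurd heq (comap_ne_comap (surjective_prod_swap h) hGt H)
    · rintro ⟨H, ⟨hH, hHd⟩, rfl⟩
      exact ⟨⟨H, hH, rfl⟩, (hA.deletion h hH₁).left_mem hHd⟩
  have h2 : ∀ B ∈ π₂, Submodule.comap g '' B ∩ (A.deletion (H₁.comap f)).hyperplanes =
      Submodule.comap g '' B := by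
    intro B hB
    refine Set.inter_eq_left.2 ?_
    rintro _ ⟨G, hG, rfl⟩
    exact (hA.deletion h hH₁).right_mem (hπ₂.subset hB hG)
  ext C
  constructor
  · rintro ⟨hne, _, ⟨B, hB, rfl⟩ | ⟨B, hB, rfl⟩, rfl⟩
    · rw [h1] at hne ⊢
      exact Or.inl ⟨_, ⟨Set.image_nonempty.1 hne, B, hB, rfl⟩, rfl⟩
    · rw [h2 B hB]
      exact Or.inr ⟨B, hB, rfl⟩
  · rintro (⟨_, ⟨hne, B, hB, rfl⟩, rfl⟩ | ⟨B, hB, rfl⟩)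
    · exact ⟨hne.image _, _, Or.inl ⟨B, hB, rfl⟩, (h1 B).symm⟩
    · exact ⟨(hπ₂.nonempty B hB).image _, _, Or.inr ⟨B, hB, rfl⟩, (h2 B hB).symm⟩

theorem restrictionPartition_jointPartition (h : Function.Surjective (f.prod g))
    (hπ₁ : A₁.IsPartition π₁) (hπ₂ : A₂.IsPartition π₂) {B₁ : Set (Submodule K V)}
    (hB₁ : B₁ ∈ π₁) (H₁ : Submodule K V) :
    restrictionPartition (jointPartition f g π₁ π₂) (Submodule.comap f '' B₁) (H₁.comap f) =
      jointPartition (comapRestrict f H₁) (g ∘ₗ (H₁.comap f).subtype)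
        (restrictionPartition π₁ B₁ H₁) π₂ := by
  have hf := Submodule.comap_injective_of_surjective (surjective_left h)
  have h1 : ∀ B : Set (Submodule K V), interIn (H₁.comap f) '' (Submodule.comap f '' B) =
      Submodule.comap (comapRestrict f H₁) '' (interIn H₁ '' B) := fun B => by
    rw [Set.image_image, Set.image_image]; rfl
  have h2 : ∀ B : Set (Submodule K W), interIn (H₁.comap f) '' (Submodule.comap g '' B) =
      Submodule.comap (g ∘ₗ (H₁.comap f).subtype) '' B := fun B => by
    rw [Set.image_image]; rfl
  ext C
  constructor
  · rintro ⟨_, ⟨⟨B, hB, rfl⟩ | ⟨B, hB, rfl⟩, hne⟩, rfl⟩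
    · exact Or.inl ⟨_, ⟨B, ⟨hB, fun heq => hne (congrArg _ heq)⟩, rfl⟩, (h1 B).symm⟩
    · exact Or.inr ⟨B, hB, (h2 B).symm⟩
  · rintro (⟨_, ⟨B, ⟨hB, hne⟩, rfl⟩, rfl⟩ | ⟨B, hB, rfl⟩)
    · exact ⟨_, ⟨Or.inl ⟨B, hB, rfl⟩, fun heq => hne (hf.image_injective heq)⟩, h1 B⟩
    · refine ⟨_, ⟨Or.inr ⟨B, hB, rfl⟩, fun heq => ?_⟩, h2 B⟩
      have hdis := disjoint_image_comap h (hπ₁.subset hB₁) B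
      rw [Set.mem_singleton_iff] at heq
      rw [← heq, disjoint_self, Set.bot_eq_empty, Set.image_eq_empty] at hdis
      exact (hπ₂.nonempty B hB).ne_empty hdis

end Pullback

theorem isPartition_empty {K : Type*} [Field K] {V : Type*} [AddCommGroup V] [Module K V] :
    (empty K V).IsPartition ∅ where
  nonempty _ h := h.elim
  disjoint _ h := h.elim
  sUnion := Set.sUnion_empty

theorem IsInductiveFactorization.isPartition {K : Type u} [Field K] {V : Type v} [AddCommGroup V]
    [Module K V] {A : HyperplaneArrangement K V} {π : Set (Set (Submodule K V))}
    (h : IsInductiveFactorization A π) : A.IsPartition π := by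
  cases h with
  | empty => exact isPartition_empty
  | addition _ _ hπ => exact hπ

/-- The factors of inductive factorizations combine: the construction for one factor, given the
construction for all pullbacks in which that factor is empty. -/
theorem IsInductiveFactorization.joint_of_empty {K : Type u} [Field K] {V : Type v}
    [AddCommGroup V] [Module K V] {A₁ : HyperplaneArrangement K V}
    {π₁ : Set (Set (Submodule K V))} (h₁ : IsInductiveFactorization A₁ π₁)
    {W : Type*} [AddCommGroup W] [Module K W] {A₂ : HyperplaneArrangement K W}
    {π₂ : Set (Set (Submodule K W))} (hπ₂ : A₂.IsPartition π₂)
    (hempty : ∀ {U : Type w} [AddCommGroup U] [Module K U] {g : U →ₗ[K] W}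
      (_ : Function.Surjective g) {A : HyperplaneArrangement K U}
      (_ : A.hyperplanes = Submodule.comap g '' A₂.hyperplanes),
      IsInductiveFactorization A (Set.image (Submodule.comap g) '' π₂)) :
    ∀ {U : Type w} [AddCommGroup U] [Module K U] {f : U →ₗ[K] V} {g : U →ₗ[K] W}
      (_ : Function.Surjective (f.prod g)) {A : HyperplaneArrangement K U}
      (_ : IsJointPullback f g A A₁ A₂),
      IsInductiveFactorization A (jointPartition f g π₁ π₂) := by
  induction h₁ with
  | empty V =>
    intro U _ _ f g h A hA
    have hA' : A.hyperplanes = Submodule.comap g '' A₂.hyperplanes := by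
      refine Eq.trans hA ?_
      change Submodule.comap f '' ∅ ∪ _ = _
      rw [Set.image_empty, Set.empty_union]
    have := hempty (surjective_right h) hA'
    rwa [jointPartition, Set.image_empty, Set.empty_union]
  | @addition V _ _ A₁ π₁ hπ₁ B₁ hB₁ H₁ hH₁ bij _ _ ih' ih'' =>
    intro U _ _ f g h A hA
    have hH₁A := hπ₁.subset hB₁ hH₁
    refine .addition A _ (hπ₁.joint h hA hπ₂) (Submodule.comap f '' B₁) (Or.inl ⟨B₁, hB₁, rfl⟩)
      (H₁.comap f) ⟨H₁, hH₁, rfl⟩ (bijOn_comap h hA (hπ₁.subset hB₁) hH₁ bij) ?_ ?_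
    · rw [deletionPartition_jointPartition h hA hπ₂ hH₁A]
      exact ih' h (hA.deletion h hH₁A)
    · rw [restrictionPartition_jointPartition h hπ₁ hπ₂ hB₁]
      exact ih'' (surjective_comapRestrict f g h H₁) (hA.restriction h hH₁A)

/-- Inductive factorizations pull back along surjective linear maps. -/
theorem IsInductiveFactorization.comap {K : Type u} [Field K] {V : Type v}
    [AddCommGroup V] [Module K V] {A₁ : HyperplaneArrangement K V}
    {π₁ : Set (Set (Submodule K V))} (h₁ : IsInductiveFactorization A₁ π₁)
    {U : Type w} [AddCommGroup U] [Module K U] {f : U →ₗ[K] V}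
    (hf : Function.Surjective f) {A : HyperplaneArrangement K U}
    (hA : A.hyperplanes = Submodule.comap f '' A₁.hyperplanes) :
    IsInductiveFactorization A (Set.image (Submodule.comap f) '' π₁) := by
  -- A plain pullback is a joint one whose second factor is the empty arrangement in the zero space.
  have hsurj : Function.Surjective (f.prod (0 : U →ₗ[K] PUnit.{1})) := fun p =>
    (hf p.1).imp fun _ hu => Prod.ext hu rfl
  have h := h₁.joint_of_empty (isPartition_empty (K := K) (V := PUnit.{1}))
    (fun {U} _ _ g _ {A} hA => by
      refine isInductiveFactorization_empty_of_hyperplanes ?_ (Set.image_empty _)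
      rw [hA]
      exact Set.image_empty _) hsurj (A := A) (by
      refine hA.trans ?_
      change _ = _ ∪ Submodule.comap _ '' ∅
      rw [Set.image_empty, Set.union_empty])
  rwa [jointPartition, Set.image_empty, Set.union_empty] at h

theorem IsInductiveFactorization.joint {K : Type u} [Field K] {V : Type v}
    [AddCommGroup V] [Module K V] {A₁ : HyperplaneArrangement K V}
    {π₁ : Set (Set (Submodule K V))} (h₁ : IsInductiveFactorization A₁ π₁)
    {W : Type*} [AddCommGroup W] [Module K W] {A₂ : HyperplaneArrangement K W}
    {π₂ : Set (Set (Submodule K W))} (h₂ : IsInductiveFactorization A₂ π₂)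
    {U : Type w} [AddCommGroup U] [Module K U] {f : U →ₗ[K] V} {g : U →ₗ[K] W}
    (h : Function.Surjective (f.prod g)) {A : HyperplaneArrangement K U}
    (hA : IsJointPullback f g A A₁ A₂) :
    IsInductiveFactorization A (jointPartition f g π₁ π₂) :=
  h₁.joint_of_empty h₂.isPartition (fun hg _ hA => h₂.comap hg hA) h hA

/-! ### The product arrangement and its blocks -/

section Product

variable {K : Type*} [Field K] {V : Type*} [AddCommGroup V] [Module K V]
  {W : Type*} [AddCommGroup W] [Module K W]

theorem surjective_fst_prod_snd :
    Function.Surjective ((LinearMap.fst K V W).prod (LinearMap.snd K V W)) := fun p => ⟨p, rfl⟩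

theorem isJointPullback_prod (A₁ : HyperplaneArrangement K V) (A₂ : HyperplaneArrangement K W) :
    IsJointPullback (LinearMap.fst K V W) (LinearMap.snd K V W) (A₁.prod A₂) A₁ A₂ := by
  have h1 : ∀ H : Submodule K V, H.prod (⊤ : Submodule K W) = H.comap (LinearMap.fst K V W) :=
    fun H => by ext; simp
  have h2 : ∀ H : Submodule K W, (⊤ : Submodule K V).prod H = H.comap (LinearMap.snd K V W) :=
    fun H => by ext; simp
  change _ '' _ ∪ _ '' _ = _
  rw [Set.image_congr fun H _ => h1 H, Set.image_congr fun H _ => h2 H]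

theorem ncard_filter_image_comap {U : Type*} [AddCommGroup U] [Module K U] {f : U →ₗ[K] V}
    (hf : Function.Surjective f) (π : Set (Set (Submodule K V))) (k : ℕ) :
    {C ∈ Set.image (Submodule.comap f) '' π | C.ncard = k}.ncard =
      {B ∈ π | B.ncard = k}.ncard := by
  have hinj := Submodule.comap_injective_of_surjective hf
  have : {C ∈ Set.image (Submodule.comap f) '' π | C.ncard = k} =
      Set.image (Submodule.comap f) '' {B ∈ π | B.ncard = k} := by
    ext C
    constructor
    · rintro ⟨⟨B, hB, rfl⟩, hC⟩
      rw [Set.ncard_image_of_injective _ hinj] at hC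
      exact ⟨B, ⟨hB, hC⟩, rfl⟩
    · rintro ⟨B, ⟨hB, hC⟩, rfl⟩
      exact ⟨⟨B, hB, rfl⟩, by rwa [Set.ncard_image_of_injective _ hinj]⟩
  rw [this, Set.ncard_image_of_injective _ hinj.image_injective]

theorem ncard_filter_jointPartition {U : Type*} [AddCommGroup U] [Module K U] {f : U →ₗ[K] V}
    {g : U →ₗ[K] W} (h : Function.Surjective (f.prod g)) {A₁ : HyperplaneArrangement K V}
    {A₂ : HyperplaneArrangement K W} {π₁ : Set (Set (Submodule K V))}
    {π₂ : Set (Set (Submodule K W))} (hπ₁ : A₁.IsPartition π₁) (hπ₂ : A₂.IsPartition π₂) (k : ℕ) :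
    {C ∈ jointPartition f g π₁ π₂ | C.ncard = k}.ncard =
      {B ∈ π₁ | B.ncard = k}.ncard + {B ∈ π₂ | B.ncard = k}.ncard := by
  have hunion : {C ∈ jointPartition f g π₁ π₂ | C.ncard = k} =
      {C ∈ Set.image (Submodule.comap f) '' π₁ | C.ncard = k} ∪
        {C ∈ Set.image (Submodule.comap g) '' π₂ | C.ncard = k} := by
    ext C
    exact or_and_right
  have hdisj : Disjoint {C ∈ Set.image (Submodule.comap f) '' π₁ | C.ncard = k}
      {C ∈ Set.image (Submodule.comap g) '' π₂ | C.ncard = k} := by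
    refine Set.disjoint_left.2 ?_
    rintro _ ⟨⟨B, hB, rfl⟩, _⟩ ⟨⟨C, hC, heq⟩, _⟩
    have hdis := disjoint_image_comap h (hπ₁.subset hB) C
    rw [heq, disjoint_self, Set.bot_eq_empty, Set.image_eq_empty] at hdis
    exact (hπ₁.nonempty B hB).ne_empty hdis
  rw [hunion, Set.ncard_union_eq hdisj ((hπ₁.finite.image _).subset fun _ h => h.1)
    ((hπ₂.finite.image _).subset fun _ h => h.1), ncard_filter_image_comap (surjective_left h),
    ncard_filter_image_comap (surjective_right h)]

end Product

end HyperplaneArrangement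

open HyperplaneArrangement

theorem mainTheorem7 {K : Type*} [Field K]
    {V₁ : Type*} [AddCommGroup V₁] [Module K V₁] [FiniteDimensional K V₁]
    {V₂ : Type*} [AddCommGroup V₂] [Module K V₂] [FiniteDimensional K V₂]
    (A₁ : HyperplaneArrangement K V₁) (A₂ : HyperplaneArrangement K V₂) :
    ((A₁.prod A₂).IsInductivelyFactored ↔
      A₁.IsInductivelyFactored ∧ A₂.IsInductivelyFactored) ∧
    ((A₁.prod A₂).IsInductivelyFactored →
      (∃ E₁ : Multiset ℕ, A₁.IsFreeWithExponents E₁) ∧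
      (∃ E₂ : Multiset ℕ, A₂.IsFreeWithExponents E₂) ∧
      ∀ E₁ E₂ : Multiset ℕ, A₁.IsFreeWithExponents E₁ → A₂.IsFreeWithExponents E₂ →
        ∀ E : Multiset ℕ, (A₁.prod A₂).IsFreeWithExponents E ↔ E = E₁ + E₂) := by
  have hA := isJointPullback_prod A₁ A₂
  have hsurj := surjective_fst_prod_snd (K := K) (V := V₁) (W := V₂)
  have hiff : (A₁.prod A₂).IsInductivelyFactored ↔
      A₁.IsInductivelyFactored ∧ A₂.IsInductivelyFactored := by
    constructor
    · rintro ⟨π, hπ⟩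
      exact ⟨⟨_, hπ.induced hsurj hA⟩, ⟨_, hπ.induced (surjective_prod_swap hsurj) hA.symm⟩⟩
    · rintro ⟨⟨π₁, hπ₁⟩, ⟨π₂, hπ₂⟩⟩
      exact ⟨_, hπ₁.joint hπ₂ hsurj hA⟩
  refine ⟨hiff, fun h => ?_⟩
  obtain ⟨⟨π₁, hπ₁⟩, ⟨π₂, hπ₂⟩⟩ := hiff.1 h
  obtain ⟨F₁, hF₁, hcard₁, hcount₁⟩ := hπ₁.exists_exponents
  obtain ⟨F₂, hF₂, hcard₂, hcount₂⟩ := hπ₂.exists_exponents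
  obtain ⟨F, hF, hcard, hcount⟩ := (hπ₁.joint hπ₂ hsurj hA).exists_exponents
  -- Blocks of each positive size add up, and so do the dimensions, which settles the zeros.
  have hsum : F = F₁ + F₂ := by
    refine Multiset.eq_of_count_pos ?_ fun k hk => ?_
    · rw [Multiset.card_add, hcard, hcard₁, hcard₂, Module.finrank_prod]
    · rw [Multiset.count_add, hcount k hk, hcount₁ k hk, hcount₂ k hk,
        ncard_filter_jointPartition hsurj hπ₁.isPartition hπ₂.isPartition]
  refine ⟨⟨F₁, hF₁⟩, ⟨F₂, hF₂⟩, fun E₁ E₂ hE₁ hE₂ E => ?_⟩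
  rw [hE₁.unique hF₁, hE₂.unique hF₂, ← hsum]
  exact ⟨fun hE => hE.unique hF, fun hE => hE ▸ hF⟩
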